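/- Let $\mathbb{K}$ be a field, let $Q$ be a finite connected (non-empty) quiver, let $J$ be the two-sided ideal of the path algebra $\mathbb{K}Q$ generated by the arrows, and let $A=\mathbb{K}Q/J^2$ be the associated radical square zero algebra. All modules are finitely generated right $A$-modules, and $\Omega(M)$ denotes the kernel of the projective cover of $M$. Let $K_0$ be the quotient of the free abelian group on the symbols $[M]$, one for each isomorphism class of modules, by the relations $[M]=[M']+[M'']$ whenever $M\cong M'\oplus M''$, and $[P]=0$ for $P$ projective. Let $\overline{\Omega}:K_0\to K_0$ be the endomorphism induced by $\Omega$. For a module $M$ let $\langle \operatorname{add} M\rangle\subseteq K_0$ be the subgroup generated by the classes of the indecomposable direct summands of $M$, and put $$\phi(M)=\min\{\,l\in\mathbb{N} : \overline{\Omega}\text{ is injective on }\overline{\Omega}^{\,l+s}\langle \operatorname{add} M\rangle\text{ for all }s\in\mathbb{N}\,\},\qquad \phi\dim(A)=\sup_M\phi(M).$$ Let $\mathcal{S}_D$ be a complete set of representatives of the isomorphism classes of simple modules that are neither projective nor injective. **Proposition.** If $A$ is not selfinjective, then $$\phi\dim(A)=\phi\Big(\bigoplus_{S\in\mathcal{S}_D}S\Big)+1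 .$$ In particular $\phi\dim(A)$ is finite, and there is a module $M$ with $\phi(M)=\phi\dim(A)$. -/

import Mathlib

universe u v w

/-! ### Path algebras and radical square zero algebras -/

section PathAlgebra

/-- All paths of the quiver `V`, with their endpoints (trivial paths included). -/
abbrev TotalPath (V : Type v) [Quiver.{w} V] : Type (max v w) :=
  Σ a b : V, Quiver.Path a b

/-- The underlying vector space of the path algebra `kQ`: the paths form a basis. -/
def PathAlgebra (k : Type u) [Field k] (V : Type v) [Quiver.{w} V] : Type (max u v w) :=
  TotalPath V →₀ k

variable (k : Type u) [Field k] (V : Type v) [Quiver.{w} V]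

noncomputable instance : AddCommGroup (PathAlgebra k V) :=
  inferInstanceAs (AddCommGroup (TotalPath V →₀ k))

noncomputable instance : Module k (PathAlgebra k V) :=
  inferInstanceAs (Module k (TotalPath V →₀ k))

namespace PathAlgebra

variable {V}

/-- The paths form a basis of the path algebra. -/
noncomputable def basis : Module.Basis (TotalPath V) k (PathAlgebra k V) :=
  ⟨LinearEquiv.refl k (TotalPath V →₀ k)⟩

/-- The basis element of a path. -/
noncomputable def path {a b : V} (p : Quiver.Path a b) : PathAlgebra k V :=
  basis k ⟨a, b, p⟩

open Classical in
/-- The product of two paths: first `p`, then `q`, if `p` ends where `q` starts; otherwise `0`. -/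
noncomputable def mulPath (p q : TotalPath V) : PathAlgebra k V :=
  if h : q.1 = p.2.1 then path k (p.2.2.comp (q.2.2.cast h rfl)) else 0

/-- Bilinear extension of the product of paths. -/
noncomputable def mulLin : PathAlgebra k V →ₗ[k] PathAlgebra k V →ₗ[k] PathAlgebra k V :=
  (basis k).constr k fun p => (basis k).constr k fun q => mulPath k p q

variable {k}

theorem mulLin_path_path {a b c : V} (p : Quiver.Path a b) (q : Quiver.Path b c) :
    mulLin k (path k p) (path k q) = path k (p.comp q) := by
  simp [mulLin, path, Module.Basis.constr_basis, mulPath]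

theorem mulLin_path_ne {a b c d : V} (p : Quiver.Path a b) (q : Quiver.Path c d) (h : c ≠ b) :
    mulLin k (path k p) (path k q) = 0 := by
  simp [mulLin, path, Module.Basis.constr_basis, mulPath, h]

theorem induction_path {C : PathAlgebra k V → Prop} (x : PathAlgebra k V) (h0 : C 0)
    (hadd : ∀ x y, C x → C y → C (x + y))
    (hs : ∀ (r : k) {a b : V} (p : Quiver.Path a b), C (r • path k p)) : C x := by
  rw [← (basis k).linearCombination_repr x, Finsupp.linearCombination_apply, Finsupp.sum]
  exact Finset.sum_induction _ C hadd h0 fun p _ => hs _ p.2.2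

theorem mulLin_assoc (x y z : PathAlgebra k V) :
    mulLin k (mulLin k x y) z = mulLin k x (mulLin k y z) := by
  induction x using induction_path with
  | h0 => simp
  | hadd x x' hx hx' => simp [hx, hx']
  | hs r p =>
  induction y using induction_path with
  | h0 => simp
  | hadd x x' hx hx' => simp only [map_add, LinearMap.add_apply, hx, hx']
  | hs s q =>
  induction z using induction_path with
  | h0 => simp
  | hadd x x' hx hx' => simp only [map_add, hx, hx']
  | hs t m =>
  rename_i a b c d e f
  simp only [map_smul, LinearMap.smul_apply]
  congr 3
  by_cases h1 : c = b
  · subst h1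
    rw [mulLin_path_path]
    by_cases h2 : e = d
    · subst h2
      rw [mulLin_path_path, mulLin_path_path, mulLin_path_path, Quiver.Path.comp_assoc]
    · rw [mulLin_path_ne _ _ h2, mulLin_path_ne _ _ h2, map_zero]
  · rw [mulLin_path_ne _ _ h1, map_zero, LinearMap.zero_apply]
    by_cases h2 : e = d
    · subst h2
      rw [mulLin_path_path, mulLin_path_ne _ _ h1]
    · rw [mulLin_path_ne _ _ h2, map_zero]

section Fin

variable [Fintype V]

variable (k V) in
/-- The unit of the path algebra: the sum of the trivial paths. -/
noncomputable def unit : PathAlgebra k V :=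
  ∑ a : V, path k (Quiver.Path.nil : Quiver.Path a a)

theorem unit_mulLin (x : PathAlgebra k V) : mulLin k (unit k V) x = x := by
  induction x using induction_path with
  | h0 => simp
  | hadd x x' hx hx' => simp [hx, hx']
  | hs r p =>
  rename_i a b
  rw [map_smul]
  congr 1
  unfold unit
  rw [map_sum, LinearMap.sum_apply, Finset.sum_eq_single a]
  · rw [mulLin_path_path, Quiver.Path.nil_comp]
  · intro c _ hc
    exact mulLin_path_ne _ _ hc.symm
  · simp

theorem mulLin_unit (x : PathAlgebra k V) : mulLin k x (unit k V) = x := by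
  induction x using induction_path with
  | h0 => simp
  | hadd x x' hx hx' => simp [hx, hx']
  | hs r p =>
  rename_i a b
  rw [map_smul, LinearMap.smul_apply]
  congr 1
  unfold unit
  rw [map_sum, Finset.sum_eq_single b]
  · rw [mulLin_path_path, Quiver.Path.comp_nil]
  · intro c _ hc
    exact mulLin_path_ne _ _ hc
  · simp

/-- The path algebra `kQ` of a quiver with finitely many vertices. -/
noncomputable instance instRing : Ring (PathAlgebra k V) :=
  { (inferInstance : AddCommGroup (PathAlgebra k V)) with
    mul := fun x y => mulLin k x y
    one := unit k V
    left_distrib := fun x y z => map_add (mulLin k x) y z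
    right_distrib := fun x y z => by
      change mulLin k (x + y) z = _
      rw [map_add, LinearMap.add_apply]
      rfl
    zero_mul := fun x => by
      change mulLin k 0 x = 0
      simp
    mul_zero := fun x => map_zero (mulLin k x)
    mul_assoc := mulLin_assoc
    one_mul := unit_mulLin
    mul_one := mulLin_unit }

theorem mul_def (x y : PathAlgebra k V) : x * y = mulLin k x y := rfl

noncomputable instance instAlgebra : Algebra k (PathAlgebra k V) :=
  Algebra.ofModule
    (fun r x y => by rw [mul_def, map_smul, LinearMap.smul_apply, mul_def])
    (fun r x y => by rw [mul_def, map_smul, mul_def])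

variable (k V)

/-- The two-sided ideal `J` of `kQ` generated by the arrows. -/
noncomputable def arrowIdeal : Ideal (PathAlgebra k V) :=
  (TwoSidedIdeal.span
    {x : PathAlgebra k V | ∃ (a b : V) (e : a ⟶ b), x = path k e.toPath}).asIdeal

instance : (arrowIdeal k V).IsTwoSided := by
  unfold arrowIdeal
  infer_instance

end Fin

end PathAlgebra

variable [Fintype V]

/-- The radical square zero algebra `kQ / J²`. -/
abbrev RadSqZeroAlgebra : Type (max u v w) :=
  PathAlgebra k V ⧸ PathAlgebra.arrowIdeal k V * PathAlgebra.arrowIdeal k V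

namespace RadSqZeroAlgebra

variable {V}

theorem path_mem_arrowIdeal {a b : V} (p : Quiver.Path a b) (hp : p.length ≠ 0) :
    PathAlgebra.path k p ∈ PathAlgebra.arrowIdeal k V := by
  cases p with
  | nil => exact absurd rfl hp
  | cons p e =>
    have h1 : PathAlgebra.path k (p.cons e)
        = PathAlgebra.path k p * PathAlgebra.path k e.toPath := by
      rw [PathAlgebra.mul_def, PathAlgebra.mulLin_path_path]
      rfl
    rw [h1]
    refine Ideal.mul_mem_left _ _ ?_
    unfold PathAlgebra.arrowIdeal
    rw [TwoSidedIdeal.mem_asIdeal]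
    exact TwoSidedIdeal.subset_span ⟨_, _, e, rfl⟩

theorem mk_path_eq_zero {a b : V} (p : Quiver.Path a b) (hp : 2 ≤ p.length) :
    Ideal.Quotient.mk (PathAlgebra.arrowIdeal k V * PathAlgebra.arrowIdeal k V) (PathAlgebra.path k p) = 0 := by
  cases p with
  | nil => simp at hp
  | cons p e =>
    have h1 : PathAlgebra.path k (p.cons e)
        = PathAlgebra.path k p * PathAlgebra.path k e.toPath := by
      rw [PathAlgebra.mul_def, PathAlgebra.mulLin_path_path]
      rfl
    rw [h1, Ideal.Quotient.eq_zero_iff_mem]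
    refine Ideal.mul_mem_mul (path_mem_arrowIdeal k p ?_)
      (path_mem_arrowIdeal k e.toPath (by simp))
    rw [Quiver.Path.length_cons] at hp
    omega

variable (V) [∀ a b : V, Finite (a ⟶ b)]

instance instFinite : Module.Finite k (RadSqZeroAlgebra k V) := by
  classical
  let f : (V ⊕ Σ a b : V, (a ⟶ b)) → RadSqZeroAlgebra k V :=
    Sum.elim (fun a => Ideal.Quotient.mk _ (PathAlgebra.path k (Quiver.Path.nil : Quiver.Path a a)))
      (fun e => Ideal.Quotient.mk _ (PathAlgebra.path k e.2.2.toPath))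
  refine ⟨(Set.finite_range f).toFinset, ?_⟩
  rw [Set.Finite.coe_toFinset, eq_top_iff]
  rintro x -
  obtain ⟨x, rfl⟩ := Ideal.Quotient.mk_surjective x
  induction x using PathAlgebra.induction_path with
  | h0 => rw [map_zero]; exact zero_mem _
  | hadd x y hx hy => rw [map_add]; exact add_mem hx hy
  | hs r p =>
    have h1 : Ideal.Quotient.mk (PathAlgebra.arrowIdeal k V * PathAlgebra.arrowIdeal k V) (r • PathAlgebra.path k p)
        = r • Ideal.Quotient.mk (PathAlgebra.arrowIdeal k V * PathAlgebra.arrowIdeal k V) (PathAlgebra.path k p) := rfl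
    rw [h1]
    refine Submodule.smul_mem _ _ ?_
    cases p with
    | nil => exact Submodule.subset_span ⟨Sum.inl _, rfl⟩
    | cons p e =>
      cases p with
      | nil => exact Submodule.subset_span ⟨Sum.inr ⟨_, _, e⟩, rfl⟩
      | cons p e' =>
        rw [mk_path_eq_zero k _ (by simp only [Quiver.Path.length_cons]; omega)]
        exact zero_mem _

instance instArtinian : IsArtinianRing (RadSqZeroAlgebra k V)ᵐᵒᵖ :=
  isArtinian_of_tower k (inferInstance : IsArtinian k (RadSqZeroAlgebra k V)ᵐᵒᵖ)

end RadSqZeroAlgebra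

end PathAlgebra

/-! ### Minimal syzygies, the group `K₀` and the Igusa-Todorov function

Everything is stated for finitely generated left modules over an Artinian ring `R`; right
modules over an algebra `A` are modules over `Aᵐᵒᵖ`. -/

namespace IgusaTodorov

/-- `f : P → M` is a projective cover: `P` is projective, `f` is onto and its kernel is
superfluous. -/
structure IsProjectiveCover {R : Type u} [Ring R] {P M : Type v} [AddCommGroup P] [Module R P]
    [AddCommGroup M] [Module R M] (f : P →ₗ[R] M) : Prop where
  projective : Module.Projective R P
  surjective : Function.Surjective f
  superfluous : ∀ N : Submodule R P, N ⊔ LinearMap.ker f = ⊤ → N = ⊤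

section

variable {R : Type u} [Ring R]

theorem sup_ker_eq_top_iff {P M : Type v} [AddCommGroup P] [Module R P]
    [AddCommGroup M] [Module R M] (f : P →ₗ[R] M) (hf : Function.Surjective f)
    (N : Submodule R P) : N ⊔ LinearMap.ker f = ⊤ ↔ N.map f = ⊤ := by
  rw [← Submodule.comap_map_eq]
  constructor
  · intro h
    rw [eq_top_iff]
    rintro y -
    obtain ⟨x, rfl⟩ := hf y
    have : x ∈ Submodule.comap f (Submodule.map f N) := h ▸ Submodule.mem_top
    exact this
  · intro h
    rw [h, Submodule.comap_top]

theorem exists_projectiveCover [IsArtinianRing R] (M : FGModuleCat.{u} R) :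
    ∃ (P : FGModuleCat.{u} R) (f : P →ₗ[R] M), IsProjectiveCover f := by
  obtain ⟨n, f, hf⟩ := Module.Finite.exists_fin' R M
  let P := Fin n → R
  -- a minimal submodule mapping onto `M`
  obtain ⟨N, hN, hmin⟩ := WellFounded.has_min (wellFounded_lt (α := Submodule R P))
    {N | N.map f = ⊤} ⟨⊤, by simpa [LinearMap.range_eq_top] using hf⟩
  have hN' : N.map f = ⊤ := hN
  let g : N →ₗ[R] M := f.comp N.subtype
  have hg : Function.Surjective g := by
    intro y
    have : y ∈ N.map f := hN' ▸ Submodule.mem_top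
    obtain ⟨x, hx, rfl⟩ := this
    exact ⟨⟨x, hx⟩, rfl⟩
  have hkey : ∀ L : Submodule R N, L.map g = ⊤ → L = ⊤ := by
    intro L hL
    have h1 : (L.map N.subtype).map f = ⊤ := by
      rw [← Submodule.map_comp]
      exact hL
    have h2 : ¬ (L.map N.subtype < N) := hmin _ h1
    have h3 : L.map N.subtype = N := by
      by_contra h
      exact h2 (lt_of_le_of_ne (Submodule.map_subtype_le _ _) h)
    rw [eq_top_iff]
    rintro x -
    have : (x : P) ∈ L.map N.subtype := h3.symm ▸ x.2
    obtain ⟨y, hy, hxy⟩ := this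
    have : y = x := Subtype.ext hxy
    exact this ▸ hy
  obtain ⟨q, hq⟩ := Module.projective_lifting_property g f hg
  let e : N →ₗ[R] N := q.comp N.subtype
  have he : Function.Surjective e := by
    rw [← LinearMap.range_eq_top]
    apply hkey
    rw [← LinearMap.range_comp]
    have : g.comp e = g := by
      change g.comp (q.comp N.subtype) = _
      rw [← LinearMap.comp_assoc, hq]
    rw [this, LinearMap.range_eq_top]
    exact hg
  have hinj : Function.Injective e := IsNoetherian.injective_of_surjective_endomorphism e he
  let e' := LinearEquiv.ofBijective e ⟨hinj, he⟩
  have hproj : Module.Projective R N := by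
    refine Module.Projective.of_split (M := P) N.subtype (e'.symm.toLinearMap.comp q) ?_
    refine LinearMap.ext fun x => ?_
    exact e'.symm_apply_apply x
  exact ⟨FGModuleCat.of R N, g, hproj, hg, fun L hL => hkey L ((sup_ker_eq_top_iff g hg L).1 hL)⟩

/-- Isomorphism of finitely generated modules. -/
def isoSetoid (R : Type u) [Ring R] : Setoid (FGModuleCat.{u} R) where
  r M N := Nonempty (M ≃ₗ[R] N)
  iseqv := ⟨fun M => ⟨LinearEquiv.refl R M⟩, fun ⟨e⟩ => ⟨e.symm⟩, fun ⟨e⟩ ⟨e'⟩ => ⟨e.trans e'⟩⟩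

/-- Isomorphism classes of finitely generated `R`-modules. -/
abbrev IsoClass (R : Type u) [Ring R] : Type (u + 1) :=
  Quotient (isoSetoid R)

/-- The symbol of a module in the free abelian group on the isomorphism classes. -/
def symbol (M : FGModuleCat.{u} R) : FreeAbelianGroup (IsoClass R) :=
  FreeAbelianGroup.of (Quotient.mk (isoSetoid R) M)

/-- The relations `[M] - [M'] - [M'']` for `M ≅ M' ⊕ M''`, and `[P]` for `P` projective. -/
inductive IsRelation : FreeAbelianGroup (IsoClass R) → Prop
  | sum (M M' M'' : FGModuleCat.{u} R) (h : Nonempty (M ≃ₗ[R] M' × M'')) :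
      IsRelation (symbol M - symbol M' - symbol M'')
  | projective (P : FGModuleCat.{u} R) (h : Module.Projective R P) : IsRelation (symbol P)

variable (R) in
/-- The subgroup generated by the relations. -/
def relations : AddSubgroup (FreeAbelianGroup (IsoClass R)) :=
  AddSubgroup.closure {x | IsRelation x}

variable (R) in
/-- The group `K₀`. -/
abbrev K0 : Type (u + 1) :=
  FreeAbelianGroup (IsoClass R) ⧸ relations R

/-- The class `[M]` in `K₀`. -/
def K0.mk (M : FGModuleCat.{u} R) : K0 R :=
  QuotientAddGroup.mk (symbol M)

theorem K0.mk_eq_add {M M' M'' : FGModuleCat.{u} R} (e : M ≃ₗ[R] M' × M'') :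
    K0.mk M = K0.mk M' + K0.mk M'' := by
  have h : ((symbol M - symbol M' - symbol M'' : FreeAbelianGroup (IsoClass R)) : K0 R) = 0 :=
    (QuotientAddGroup.eq_zero_iff _).2 (AddSubgroup.subset_closure (.sum M M' M'' ⟨e⟩))
  rw [QuotientAddGroup.mk_sub, QuotientAddGroup.mk_sub, sub_sub, sub_eq_zero] at h
  exact h

theorem K0.mk_eq_zero (P : FGModuleCat.{u} R) (h : Module.Projective R P) : K0.mk P = 0 :=
  (QuotientAddGroup.eq_zero_iff _).2 (AddSubgroup.subset_closure (.projective P h))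

theorem K0.mk_congr {M N : FGModuleCat.{u} R} (e : M ≃ₗ[R] N) : K0.mk M = K0.mk N :=
  congrArg (fun c => ((FreeAbelianGroup.of c : FreeAbelianGroup (IsoClass R)) : K0 R))
    (Quotient.sound (s := isoSetoid R) ⟨e⟩)

/-- The isomorphism `P × ker g ≃ ker f × P'` attached to two projective presentations of a
module. -/
def schanuelEquiv {P P' M : Type v} [AddCommGroup P] [Module R P] [AddCommGroup P'] [Module R P']
    [AddCommGroup M] [Module R M] (f : P →ₗ[R] M) (g : P' →ₗ[R] M) (a : P →ₗ[R] P')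
    (b : P' →ₗ[R] P) (ha : ∀ x, g (a x) = f x) (hb : ∀ x, f (b x) = g x) :
    (P × LinearMap.ker g) ≃ₗ[R] (LinearMap.ker f × P') where
  toFun x := (⟨x.1 - b (x.2 + a x.1), by
    have := x.2.2
    rw [LinearMap.mem_ker] at this ⊢
    rw [map_sub, hb, map_add, ha, this]
    abel⟩, x.2 + a x.1)
  invFun y := (y.1 + b y.2, ⟨y.2 - a (y.1 + b y.2), by
    have := y.1.2
    rw [LinearMap.mem_ker] at this ⊢
    rw [map_sub, ha, map_add, hb, this]
    abel⟩)
  map_add' x y := by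
    refine Prod.ext (Subtype.ext ?_) ?_
    · simp only [Prod.fst_add, Prod.snd_add, Submodule.coe_add, map_add]
      abel
    · simp only [Prod.fst_add, Prod.snd_add, Submodule.coe_add, map_add]
      abel
  map_smul' r x := by
    refine Prod.ext (Subtype.ext ?_) ?_
    · simp [smul_sub, smul_add]
    · simp [smul_add]
  left_inv x := by
    refine Prod.ext ?_ (Subtype.ext ?_)
    · simp
    · simp
  right_inv y := by
    refine Prod.ext (Subtype.ext ?_) ?_
    · simp
    · simp

section Artinian

variable [IsArtinianRing R]

theorem mk_ker_eq {P P' M : FGModuleCat.{u} R} (hP : Module.Projective R P)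
    (hP' : Module.Projective R P') (f : P →ₗ[R] M) (g : P' →ₗ[R] M)
    (hf : Function.Surjective f) (hg : Function.Surjective g) :
    K0.mk (FGModuleCat.of R (LinearMap.ker f)) = K0.mk (FGModuleCat.of R (LinearMap.ker g)) := by
  obtain ⟨a, ha⟩ := Module.projective_lifting_property g f hg
  obtain ⟨b, hb⟩ := Module.projective_lifting_property f g hf
  have e := schanuelEquiv f g a b (fun x => LinearMap.congr_fun ha x)
    (fun x => LinearMap.congr_fun hb x)
  have h1 : K0.mk (FGModuleCat.of R (P × LinearMap.ker g)) =
      K0.mk P + K0.mk (FGModuleCat.of R (LinearMap.ker g)) :=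
    K0.mk_eq_add (LinearEquiv.refl R _)
  have h2 : K0.mk (FGModuleCat.of R (P × LinearMap.ker g)) =
      K0.mk (FGModuleCat.of R (LinearMap.ker f)) + K0.mk P' :=
    K0.mk_eq_add e
  rw [K0.mk_eq_zero P hP, zero_add] at h1
  rw [K0.mk_eq_zero P' hP', add_zero] at h2
  rw [← h1, ← h2]

/-- The projective cover `P(M)` of `M`. -/
noncomputable def coverModule (M : FGModuleCat.{u} R) : FGModuleCat.{u} R :=
  (exists_projectiveCover M).choose

/-- The projective cover `P(M) → M`. -/
noncomputable def coverMap (M : FGModuleCat.{u} R) : coverModule M →ₗ[R] M :=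
  (exists_projectiveCover M).choose_spec.choose

theorem isProjectiveCover_coverMap (M : FGModuleCat.{u} R) : IsProjectiveCover (coverMap M) :=
  (exists_projectiveCover M).choose_spec.choose_spec

/-- The (minimal) syzygy `Ω M`, the kernel of the projective cover of `M`. -/
noncomputable def syzygy (M : FGModuleCat.{u} R) : FGModuleCat.{u} R :=
  FGModuleCat.of R (LinearMap.ker (coverMap M))

theorem mk_syzygy {P M : FGModuleCat.{u} R} (hP : Module.Projective R P) (f : P →ₗ[R] M)
    (hf : Function.Surjective f) :
    K0.mk (syzygy M) = K0.mk (FGModuleCat.of R (LinearMap.ker f)) :=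
  mk_ker_eq (isProjectiveCover_coverMap M).projective hP _ f
    (isProjectiveCover_coverMap M).surjective hf

theorem mk_syzygy_congr {M N : FGModuleCat.{u} R} (e : M ≃ₗ[R] N) :
    K0.mk (syzygy M) = K0.mk (syzygy N) := by
  have hc := isProjectiveCover_coverMap M
  rw [mk_syzygy hc.projective (e.toLinearMap.comp (coverMap M))
    (e.surjective.comp hc.surjective)]
  exact K0.mk_congr (LinearEquiv.ofEq _ _ (LinearEquiv.ker_comp e (coverMap M)).symm)

theorem mk_syzygy_projective (P : FGModuleCat.{u} R) (hP : Module.Projective R P) :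
    K0.mk (syzygy P) = 0 := by
  rw [mk_syzygy hP LinearMap.id Function.surjective_id]
  apply K0.mk_eq_zero
  have : Subsingleton (LinearMap.ker (LinearMap.id : P →ₗ[R] P)) := by
    rw [LinearMap.ker_id]
    infer_instance
  exact (inferInstance : Module.Projective R (LinearMap.ker (LinearMap.id : P →ₗ[R] P)))

theorem mk_syzygy_sum {M M' M'' : FGModuleCat.{u} R} (e : M ≃ₗ[R] M' × M'') :
    K0.mk (syzygy M) = K0.mk (syzygy M') + K0.mk (syzygy M'') := by
  have h' := isProjectiveCover_coverMap M'
  have h'' := isProjectiveCover_coverMap M''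
  have hp' := h'.projective
  have hp'' := h''.projective
  let F : FGModuleCat.of R (coverModule M' × coverModule M'') →ₗ[R]
      FGModuleCat.of R (M' × M'') :=
    (coverMap M').prodMap (coverMap M'')
  have hF : Function.Surjective F := Prod.map_surjective.2 ⟨h'.surjective, h''.surjective⟩
  rw [mk_syzygy_congr (N := FGModuleCat.of R (M' × M'')) e,
    mk_syzygy (P := FGModuleCat.of R (coverModule M' × coverModule M''))
      (inferInstanceAs (Module.Projective R (coverModule M' × coverModule M''))) F hF]
  have hmem : ∀ x, F x = 0 ↔ coverMap M' x.1 = 0 ∧ coverMap M'' x.2 = 0 := fun x =>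
    Prod.mk_eq_zero
  refine K0.mk_eq_add (M' := syzygy M') (M'' := syzygy M'')
    { toFun := fun x => (⟨x.1.1, ((hmem x.1).1 x.2).1⟩, ⟨x.1.2, ((hmem x.1).1 x.2).2⟩)
      invFun := fun y => ⟨(y.1.1, y.2.1), (hmem _).2 ⟨y.1.2, y.2.2⟩⟩
      map_add' := fun _ _ => rfl
      map_smul' := fun _ _ => rfl
      left_inv := fun _ => rfl
      right_inv := fun _ => rfl }

variable (R) in
/-- The endomorphism `Ω̄` of `K₀` induced by `Ω`. -/
noncomputable def omegaBar : K0 R →+ K0 R :=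
  QuotientAddGroup.lift (relations R)
    (FreeAbelianGroup.lift fun c : IsoClass R =>
      Quotient.lift (s := isoSetoid R) (fun M => K0.mk (syzygy M))
        (fun _ _ ⟨e⟩ => mk_syzygy_congr e) c)
    (by
      unfold relations
      rw [AddSubgroup.closure_le]
      rintro x (⟨M, M', M'', ⟨e⟩⟩ | ⟨P, hP⟩)
      · simp only [SetLike.mem_coe, AddMonoidHom.mem_ker, symbol]
        change K0.mk (syzygy M) - K0.mk (syzygy M') - K0.mk (syzygy M'') = 0
        rw [mk_syzygy_sum e]
        abel
      · simp only [SetLike.mem_coe, AddMonoidHom.mem_ker, symbol]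
        exact mk_syzygy_projective P hP)

theorem omegaBar_mk (M : FGModuleCat.{u} R) : omegaBar R (K0.mk M) = K0.mk (syzygy M) := by
  change FreeAbelianGroup.lift _ (symbol M) = _
  rw [symbol, FreeAbelianGroup.lift_apply_of]
  rfl

end Artinian

/-- Indecomposable modules: nonzero, and not the direct sum of two nonzero submodules. -/
def Indecomposable (M : FGModuleCat.{u} R) : Prop :=
  Nontrivial M ∧ ∀ N N' : Submodule R M, IsCompl N N' → N = ⊥ ∨ N' = ⊥

/-- `N` is (isomorphic to) a direct summand of `M`. -/
def IsSummand (N M : FGModuleCat.{u} R) : Prop :=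
  ∃ N' : FGModuleCat.{u} R, Nonempty (M ≃ₗ[R] N × N')

/-- The subgroup `⟨add M⟩` of `K₀` generated by the classes of the indecomposable direct
summands of `M`. -/
def addSpan (M : FGModuleCat.{u} R) : AddSubgroup (K0 R) :=
  AddSubgroup.closure {x | ∃ N : FGModuleCat.{u} R,
    Indecomposable N ∧ IsSummand N M ∧ x = K0.mk N}

/-- The Igusa-Todorov function: `φ(M)` is the least `l` such that `Ω̄` is injective on
`Ω̄^(l+s) ⟨add M⟩` for all `s` (it would be `⊤` if there were no such `l`). -/
noncomputable def phi [IsArtinianRing R] (M : FGModuleCat.{u} R) : ℕ∞ :=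
  ⨅ (l : ℕ) (_ : ∀ s : ℕ, Set.InjOn (omegaBar R) ((omegaBar R)^[l + s] '' addSpan M)), (l : ℕ∞)

variable (R) in
/-- The `φ`-dimension: the supremum of `φ(M)` over all finitely generated modules `M`. -/
noncomputable def phiDim [IsArtinianRing R] : ℕ∞ :=
  ⨆ M : FGModuleCat.{u} R, phi M

/-- `M` is simple, and neither projective nor injective. -/
def IsSimpleNotProjNotInj (M : FGModuleCat.{u} R) : Prop :=
  IsSimpleModule R M ∧ ¬ Module.Projective R M ∧ ¬ Module.Injective R M

/-- The finite list `S` contains exactly one module of each isomorphism class of simple modules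
that are neither projective nor injective. -/
structure IsRepresentativeList {m : ℕ} (S : Fin m → FGModuleCat.{u} R) : Prop where
  mem : ∀ i, IsSimpleNotProjNotInj (S i)
  eq_of_iso : ∀ i j, Nonempty (S i ≃ₗ[R] S j) → i = j
  exists_iso : ∀ T : FGModuleCat.{u} R, IsSimpleNotProjNotInj T → ∃ i, Nonempty (T ≃ₗ[R] S i)

/-- The direct sum of a finite list of modules. -/
def directSum {m : ℕ} (S : Fin m → FGModuleCat.{u} R) : FGModuleCat.{u} R :=
  FGModuleCat.of R (∀ i, S i)

end

end IgusaTodorov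

/-! The heart of the matter is that `⟨add M⟩`, for `M` the direct sum of the listed simples, is
exactly the image of `Ω̄`. A syzygy lies in the radical of a projective module, so `J² = 0` makes it
semisimple (`smul_syzygy`). Its simple summands sit at targets of arrows, hence are not injective,
and those at sinks are projective and vanish in `K₀`. Conversely, an arrow `x` spans a simple left
ideal `Rx`, which is a syzygy of `R/Rx`, and every noninjective simple arises in this way
(`addSpan_directSum_eq_range`).

The formula is then nearly formal (`phiDim_eq_phi_add_one`). One application of `Ω̄` takes every
`⟨add N⟩` into `⟨add M⟩`, so `φ(N) ≤ φ(M) + 1`. In the other direction, a finite `φ`-dimension `d`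
makes `Ω̄` injective on `Ω̄^(d+s) K₀`, and if `d > 0` this set is `Ω̄^(d-1+s) ⟨add M⟩`, whence `φ(M)
≤ d - 1`. Finiteness of `φ(M)` holds because `⟨add M⟩` is finitely generated over `ℤ`.

What remains is `d = 0`, that is, `Ω̄` injective on `K₀`; this forces `R` to be self-injective.
Comparing the quotients of `R` by ideals spanned by arrows, and telling their classes apart by the
multiplicity of a simple summand, shows that arrows have distinct sources and distinct targets and
that no target is a sink. A Frobenius form then gives self-injectivity (`injective_self`). -/

namespace IgusaTodorov

/-! ### Direct summands and classes in `K₀` -/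

section Summands

variable {R : Type u} [Ring R]

theorem IsSummand.refl (M : FGModuleCat.{u} R) : IsSummand M M :=
  ⟨FGModuleCat.of R PUnit.{u + 1}, ⟨LinearEquiv.prodUnique.symm⟩⟩

theorem IsSummand.trans {L M N : FGModuleCat.{u} R} (h : IsSummand L M) (h' : IsSummand M N) :
    IsSummand L N := by
  obtain ⟨L', ⟨e⟩⟩ := h
  obtain ⟨M', ⟨e'⟩⟩ := h'
  exact ⟨FGModuleCat.of R (L' × M'),
    ⟨e'.trans ((e.prodCongr (LinearEquiv.refl R M')).trans (LinearEquiv.prodAssoc R L L' M'))⟩⟩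

theorem IsSummand.of_equiv_prod {M N N' : FGModuleCat.{u} R} (e : M ≃ₗ[R] N × N') :
    IsSummand N M :=
  ⟨N', ⟨e⟩⟩

theorem IsSummand.of_equiv_prod_right {M N N' : FGModuleCat.{u} R} (e : M ≃ₗ[R] N × N') :
    IsSummand N' M :=
  ⟨N, ⟨e.trans (LinearEquiv.prodComm R N N')⟩⟩

theorem IsSummand.exists_injective {M N : FGModuleCat.{u} R} (h : IsSummand N M) :
    ∃ f : N →ₗ[R] M, Function.Injective f := by
  obtain ⟨N', ⟨e⟩⟩ := h
  exact ⟨e.symm.toLinearMap.comp (LinearMap.inl R N N'),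
    e.symm.injective.comp LinearMap.inl_injective⟩

theorem addSpan_mono {M N : FGModuleCat.{u} R} (h : IsSummand M N) : addSpan M ≤ addSpan N := by
  refine AddSubgroup.closure_mono ?_
  rintro x ⟨L, hL, hLM, rfl⟩
  exact ⟨L, hL, hLM.trans h, rfl⟩

theorem mk_eq_zero_of_subsingleton (M : FGModuleCat.{u} R) [Subsingleton M] : K0.mk M = 0 :=
  K0.mk_eq_zero M inferInstance

/-- The class of a module of finite length is a sum of classes of indecomposable summands. -/
theorem mk_mem_addSpan [IsArtinianRing R] (M : FGModuleCat.{u} R) : K0.mk M ∈ addSpan M := by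
  induction h : Module.length R M using WellFoundedLT.induction generalizing M with
  | ind l ih =>
  subst h
  cases subsingleton_or_nontrivial M with
  | inl hM => rw [mk_eq_zero_of_subsingleton]; exact zero_mem _
  | inr hM =>
  by_cases hi : Indecomposable M
  · exact AddSubgroup.subset_closure ⟨M, hi, .refl M, rfl⟩
  · simp only [Indecomposable, hM, true_and, not_forall, not_or] at hi
    obtain ⟨N, N', hc, hN, hN'⟩ := hi
    let e : M ≃ₗ[R] FGModuleCat.of R N × FGModuleCat.of R N' :=
      (Submodule.prodEquivOfIsCompl N N' hc).symm
    have hN1 : N ≠ ⊤ := fun hn => hN' (by rw [hn] at hc; exact eq_bot_of_top_isCompl hc)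
    have hN1' : N' ≠ ⊤ := fun hn => hN (by rw [hn] at hc; exact eq_bot_of_isCompl_top hc)
    rw [K0.mk_eq_add e]
    exact add_mem
      (addSpan_mono (.of_equiv_prod e) (ih _ (Submodule.length_lt hN1) (FGModuleCat.of R N) rfl))
      (addSpan_mono (.of_equiv_prod_right e)
        (ih _ (Submodule.length_lt hN1') (FGModuleCat.of R N') rfl))

theorem K0.induction {C : K0 R → Prop} (x : K0 R) (h0 : C 0)
    (hmk : ∀ M : FGModuleCat.{u} R, C (K0.mk M)) (hneg : ∀ x, C x → C (-x))
    (hadd : ∀ x y, C x → C y → C (x + y)) : C x := by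
  obtain ⟨x, rfl⟩ := QuotientAddGroup.mk_surjective x
  induction x using FreeAbelianGroup.induction_on with
  | zero => exact h0
  | of c => induction c using Quotient.inductionOn with | h M => exact hmk M
  | neg c h => exact hneg _ h
  | add x y hx hy => exact hadd _ _ hx hy

theorem exists_mem_addSpan [IsArtinianRing R] (x : K0 R) :
    ∃ M : FGModuleCat.{u} R, x ∈ addSpan M := by
  induction x using K0.induction with
  | h0 => exact ⟨FGModuleCat.of R PUnit.{u + 1}, zero_mem _⟩
  | hmk M => exact ⟨M, mk_mem_addSpan M⟩
  | hneg x h =>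
    obtain ⟨M, hM⟩ := h
    exact ⟨M, neg_mem hM⟩
  | hadd x y hx hy =>
    obtain ⟨M, hM⟩ := hx
    obtain ⟨N, hN⟩ := hy
    exact ⟨FGModuleCat.of R (M × N), add_mem
      (addSpan_mono (.of_equiv_prod (M := FGModuleCat.of R (M × N)) (LinearEquiv.refl R _)) hM)
      (addSpan_mono (.of_equiv_prod_right (M := FGModuleCat.of R (M × N))
        (LinearEquiv.refl R _)) hN)⟩

/-- `K₀` is the directed union of the subgroups `⟨add M⟩`, so injectivity on the images of all of
them is injectivity on the image of `K₀`. -/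
theorem exists_mem_addSpan_pair [IsArtinianRing R] (x y : K0 R) :
    ∃ M : FGModuleCat.{u} R, x ∈ addSpan M ∧ y ∈ addSpan M := by
  obtain ⟨M, hM⟩ := exists_mem_addSpan x
  obtain ⟨N, hN⟩ := exists_mem_addSpan y
  exact ⟨FGModuleCat.of R (M × N),
    addSpan_mono (.of_equiv_prod (M := FGModuleCat.of R (M × N)) (LinearEquiv.refl R _)) hM,
    addSpan_mono (.of_equiv_prod_right (M := FGModuleCat.of R (M × N))
      (LinearEquiv.refl R _)) hN⟩

/-- An indecomposable semisimple module is simple. -/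
theorem Indecomposable.isSimpleModule {M : FGModuleCat.{u} R} (h : Indecomposable M)
    [IsSemisimpleModule R M] : IsSimpleModule R M := by
  have := h.1
  obtain ⟨N, hN⟩ := IsSemisimpleModule.exists_simple_submodule R M
  obtain ⟨N', hc⟩ := exists_isCompl N
  rcases h.2 N N' hc with h1 | h1
  · exact absurd h1 (isSimpleModule_iff_isAtom.1 hN).1
  · rw [h1] at hc
    rw [eq_top_of_isCompl_bot hc] at hN
    exact IsSimpleModule.congr Submodule.topEquiv.symm

theorem indecomposable_of_isSimpleModule (M : FGModuleCat.{u} R) [IsSimpleModule R M] :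
    Indecomposable M := by
  refine ⟨IsSimpleModule.nontrivial R M, fun N N' hc => ?_⟩
  rcases eq_bot_or_eq_top N with h | h
  · exact .inl h
  · rw [h] at hc
    exact .inr (eq_bot_of_top_isCompl hc)

end Summands

/-! ### The function `φ` and the iterates of `Ω̄` -/

section Phi

variable {R : Type u} [Ring R] [IsArtinianRing R]

/-- The admissible `l` form an upward closed set, so an infimum at most `n` makes `n` itself
admissible. -/
theorem phi_le_iff (M : FGModuleCat.{u} R) (n : ℕ) :
    phi M ≤ n ↔ ∀ s, Set.InjOn (omegaBar R) ((omegaBar R)^[n + s] '' addSpan M) := by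
  constructor
  · intro h s
    have h1 : phi M < ((n + 1 : ℕ) : ℕ∞) := lt_of_le_of_lt h (by exact_mod_cast Nat.lt_succ_self n)
    simp only [phi, iInf_lt_iff] at h1
    obtain ⟨l, hl, hln⟩ := h1
    have hln' : l ≤ n := Nat.lt_succ_iff.1 (by exact_mod_cast hln)
    have := hl (n - l + s)
    rwa [← add_assoc, Nat.add_sub_cancel' hln'] at this
  · intro h
    exact iInf₂_le n h

/-- `φ`-dimension at most `n` means that `Ω̄` is injective on the images of `Ω̄ⁿ⁺ˢ`. -/
theorem injOn_range_of_phiDim_le {n : ℕ} (h : phiDim R ≤ n) (s : ℕ) :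
    Set.InjOn (omegaBar R) (Set.range (omegaBar R)^[n + s]) := by
  rintro _ ⟨x, rfl⟩ _ ⟨y, rfl⟩ hxy
  obtain ⟨M, hx, hy⟩ := exists_mem_addSpan_pair x y
  exact (phi_le_iff M n).1 ((le_iSup phi M).trans h) s ⟨x, hx, rfl⟩ ⟨y, hy, rfl⟩ hxy

/-- If the image of an endomorphism of an abelian group is finitely generated, then the
endomorphism is injective on the images of all its large powers. -/
theorem exists_injOn_iterate {G : Type*} [AddCommGroup G] (f : G →+ G) (H : AddSubgroup G)
    (hH : H.FG) : ∃ n : ℕ, ∀ s, Set.InjOn f (f^[n + s] '' H) := by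
  let F : Module.End ℤ G := f.toIntLinearMap
  have hF : ∀ n x, (F ^ n) x = f^[n] x := fun n x => by
    rw [Module.End.pow_apply]; rfl
  let H' : Submodule ℤ G := AddSubgroup.toIntSubmodule H
  have : Module.Finite ℤ H' := by
    rw [Module.Finite.iff_addGroup_fg]
    exact (AddGroup.fg_iff_addSubgroup_fg H).2 hH
  -- As in Fitting's lemma: the kernels of the powers of `f` on the Noetherian group `H` form an
  -- ascending chain, and once it is stable `f` kills no nonzero element of `f^[n + s] H`.
  let c : ℕ →o Submodule ℤ H' :=
    ⟨fun n => LinearMap.ker ((F ^ n).comp H'.subtype), monotone_nat_of_le_succ fun n x hx => by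
      rw [LinearMap.mem_ker, LinearMap.comp_apply] at hx ⊢
      rw [pow_succ', Module.End.mul_apply, hx, map_zero]⟩
  obtain ⟨n, hn⟩ := monotone_stabilizes_iff_noetherian.2 (inferInstance : IsNoetherian ℤ H') c
  refine ⟨n, fun s => ?_⟩
  rintro _ ⟨x, hx, rfl⟩ _ ⟨y, hy, rfl⟩ hxy
  have hmem : (⟨x - y, sub_mem hx hy⟩ : H') ∈ c (n + s + 1) := by
    change (F ^ (n + s + 1)) (x - y) = 0
    rw [map_sub, hF, hF, sub_eq_zero, Function.iterate_succ_apply', Function.iterate_succ_apply',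
      hxy]
  rw [← hn (n + s + 1) (by omega), hn (n + s) (by omega)] at hmem
  have h1 : (F ^ (n + s)) (x - y) = 0 := hmem
  rwa [map_sub, hF, hF, sub_eq_zero] at h1

/-- If `⟨add M⟩` is the image of `Ω̄` and `Ω̄` is not injective, then the `φ`-dimension is
`φ(M) + 1`. -/
theorem phiDim_eq_phi_add_one (M : FGModuleCat.{u} R)
    (hM : (addSpan M : Set (K0 R)) = Set.range (omegaBar R)) (hfg : (addSpan M).FG)
    (hinj : ¬ Function.Injective (omegaBar R)) :
    phiDim R = phi M + 1 ∧ phiDim R ≠ ⊤ ∧ ∃ N : FGModuleCat.{u} R, phi N = phiDim R := by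
  obtain ⟨n₀, hn₀⟩ := exists_injOn_iterate (omegaBar R) (addSpan M) hfg
  have hphi : phi M ≠ ⊤ := ne_top_of_le_ne_top (ENat.natCast_ne_top n₀) ((phi_le_iff M n₀).2 hn₀)
  -- The first of the `n + 1 + s` applications of `Ω̄` already lands in `⟨add M⟩`.
  have hle : phiDim R ≤ phi M + 1 := by
    refine iSup_le fun N => ?_
    obtain ⟨n, hn⟩ := ENat.ne_top_iff_exists.1 hphi
    have h1 := (phi_le_iff M n).1 hn.ge
    rw [← hn]
    refine (phi_le_iff N (n + 1)).2 fun s => (h1 s).mono ?_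
    rintro _ ⟨x, -, rfl⟩
    refine ⟨omegaBar R x, hM ▸ ⟨x, rfl⟩, ?_⟩
    rw [← Function.iterate_succ_apply]
    congr 2
    omega
  have htop : phiDim R ≠ ⊤ := ne_top_of_le_ne_top (by simpa using hphi) hle
  refine ⟨le_antisymm hle ?_, htop, ?_⟩
  · obtain ⟨d, hd⟩ := ENat.ne_top_iff_exists.1 htop
    have h1 := injOn_range_of_phiDim_le hd.ge
    cases d with
    -- With `d = 0` and `s = 0` the iterate is the identity, so `Ω̄` would be injective on `K₀`.
    | zero =>
      refine absurd (fun x y hxy => ?_) hinj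
      exact h1 0 ⟨x, rfl⟩ ⟨y, rfl⟩ hxy
    | succ d =>
      rw [← hd]
      push_cast
      gcongr
      refine (phi_le_iff M d).2 fun s => (h1 s).mono ?_
      rw [hM]
      rintro _ ⟨_, ⟨x, rfl⟩, rfl⟩
      refine ⟨x, ?_⟩
      rw [← Function.iterate_succ_apply]
      congr 2
      omega
  -- A finite supremum in `ℕ∞` is attained.
  · exact ENat.exists_eq_iSup_of_lt_top (lt_top_iff_ne_top.2 htop)

end Phi

end IgusaTodorov

open Classical in
/-- A description of a radical square zero ring `R` over `k` by a basis of orthogonal idempotents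
`e a` and elements `x i` (the arrows) with `x i = e (target i) * x i * e (source i)` and
`x i * x j = 0`; `c` and `d` are the coordinates. -/
structure ArrowPresentation (k : Type u) [Field k] (R : Type w) [Ring R] [Algebra k R]
    (V : Type v) [Fintype V] (E : Type*) [Fintype E] where
  source : E → V
  target : E → V
  e : V → R
  x : E → R
  c : V → R →ₐ[k] k
  d : E → R →ₗ[k] k
  sum_eq : ∀ r, ∑ a, c a r • e a + ∑ i, d i r • x i = r
  c_e : ∀ a b, c a (e b) = if a = b then 1 else 0
  c_x : ∀ a i, c a (x i) = 0
  d_e : ∀ i a, d i (e a) = 0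
  d_x : ∀ i j, d i (x j) = if i = j then 1 else 0
  -- A twisted Leibniz rule. Since each `c a` is multiplicative, it determines all products, and it
  -- encodes `x i * x j = 0`.
  d_mul : ∀ i r s, d i (r * s) = c (target i) r * d i s + d i r * c (source i) s

/-! ### Coordinates on `kQ` and on `kQ / J²` -/

section Concrete

variable (k : Type u) [Field k] (V : Type v) [Quiver.{w} V]

namespace PathAlgebra

variable {V}

open Classical in
/-- The coordinate of a path at the trivial path of `a`. -/
noncomputable def nilCoordPath (a : V) : TotalPath V → k
  | ⟨b, _, .nil⟩ => if a = b then 1 else 0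
  | ⟨_, _, .cons _ _⟩ => 0

open Classical in
/-- The coordinate of a path at the arrow `i`. -/
noncomputable def arrowCoordPath (i : Σ a b : V, (a ⟶ b)) : TotalPath V → k
  | ⟨_, _, .nil⟩ => 0
  | ⟨_, _, .cons .nil e⟩ => if i = ⟨_, _, e⟩ then 1 else 0
  | ⟨_, _, .cons (.cons _ _) _⟩ => 0

/-- The coefficient of the trivial path at `a`. -/
noncomputable def nilCoord (a : V) : PathAlgebra k V →ₗ[k] k :=
  (basis k).constr k (nilCoordPath k a)

/-- The coefficient of the arrow `i`. -/
noncomputable def arrowCoord (i : Σ a b : V, (a ⟶ b)) : PathAlgebra k V →ₗ[k] k :=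
  (basis k).constr k (arrowCoordPath k i)

variable {k}

theorem nilCoord_path (a : V) {b c : V} (p : Quiver.Path b c) :
    nilCoord k a (path k p) = nilCoordPath k a ⟨b, c, p⟩ := by
  simp [nilCoord, path, Module.Basis.constr_basis]

theorem arrowCoord_path (i : Σ a b : V, (a ⟶ b)) {b c : V} (p : Quiver.Path b c) :
    arrowCoord k i (path k p) = arrowCoordPath k i ⟨b, c, p⟩ := by
  simp [arrowCoord, path, Module.Basis.constr_basis]

/-- A composite of two paths is trivial only if both paths are. -/
theorem nilCoord_mulLin (a : V) (x y : PathAlgebra k V) :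
    nilCoord k a (mulLin k x y) = nilCoord k a x * nilCoord k a y := by
  induction x using induction_path with
  | h0 => simp
  | hadd x x' hx hx' => simp [hx, hx', add_mul]
  | hs r p =>
  induction y using induction_path with
  | h0 => simp
  | hadd x x' hx hx' => rw [map_add, map_add, map_add, hx, hx', mul_add]
  | hs s q =>
  rename_i b c b' c'
  simp only [map_smul, LinearMap.smul_apply, smul_eq_mul]
  have key : nilCoord k a (mulLin k (path k p) (path k q))
      = nilCoord k a (path k p) * nilCoord k a (path k q) := by
    by_cases h : b' = c
    · subst h
      rw [mulLin_path_path, nilCoord_path, nilCoord_path, nilCoord_path]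
      cases q with
      | nil => cases p <;> simp [nilCoordPath]
      | cons q e => simp [nilCoordPath]
    · rw [mulLin_path_ne _ _ h, map_zero, nilCoord_path, nilCoord_path]
      cases p with
      | nil =>
        cases q with
        | nil =>
          simp only [nilCoordPath]
          split_ifs with h1 h2 <;> simp_all
        | cons q e => simp [nilCoordPath]
      | cons p e => simp [nilCoordPath]
  rw [key]
  ring

/-- A composite has length one exactly when one factor is an arrow and the other is the trivial path
at its matching end. -/
theorem arrowCoord_mulLin (i : Σ a b : V, (a ⟶ b)) (x y : PathAlgebra k V) :
    arrowCoord k i (mulLin k x y)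
      = nilCoord k i.1 x * arrowCoord k i y + arrowCoord k i x * nilCoord k i.2.1 y := by
  induction x using induction_path with
  | h0 => simp
  | hadd x x' hx hx' => simp only [map_add, LinearMap.add_apply, hx, hx']; ring
  | hs r p =>
  induction y using induction_path with
  | h0 => simp
  | hadd x x' hx hx' => simp only [map_add, hx, hx']; ring
  | hs s q =>
  rename_i b c b' c'
  simp only [map_smul, LinearMap.smul_apply, smul_eq_mul]
  have key : arrowCoord k i (mulLin k (path k p) (path k q))
      = nilCoord k i.1 (path k p) * arrowCoord k i (path k q)
        + arrowCoord k i (path k p) * nilCoord k i.2.1 (path k q) := by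
    by_cases h : b' = c
    · subst h
      rw [mulLin_path_path, arrowCoord_path, arrowCoord_path, arrowCoord_path, nilCoord_path,
        nilCoord_path]
      cases q with
      | nil =>
        cases p with
        | nil => simp [nilCoordPath, arrowCoordPath]
        | cons p f =>
          cases p with
          | nil =>
            simp only [nilCoordPath, arrowCoordPath, Quiver.Path.comp_nil]
            split_ifs with h1 h2 <;> first | (subst h1; simp_all) | simp_all
          | cons p f => simp [nilCoordPath, arrowCoordPath]
      | cons q e =>
        cases q with
        | nil =>
          cases p with
          | nil =>
            simp only [nilCoordPath, arrowCoordPath, Quiver.Path.nil_comp]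
            split_ifs with h1 h2 <;> first | (subst h1; simp_all) | simp_all
          | cons p f => simp [nilCoordPath, arrowCoordPath]
        | cons q f => simp [nilCoordPath, arrowCoordPath]
    · rw [mulLin_path_ne _ _ h, map_zero, arrowCoord_path, arrowCoord_path, nilCoord_path,
        nilCoord_path]
      cases q with
      | nil =>
        cases p with
        | nil => simp [nilCoordPath, arrowCoordPath]
        | cons p f =>
          cases p with
          | nil =>
            simp only [nilCoordPath, arrowCoordPath]
            split_ifs with h1 h2 <;> first | (subst h1; simp_all) | simp_all
          | cons p f => simp [nilCoordPath, arrowCoordPath]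
      | cons q e =>
        cases q with
        | nil =>
          cases p with
          | nil =>
            simp only [nilCoordPath, arrowCoordPath]
            split_ifs with h1 h2 <;> first | (subst h1; simp_all) | simp_all
          | cons p f => simp [nilCoordPath, arrowCoordPath]
        | cons q f => simp [nilCoordPath, arrowCoordPath]
  rw [key]
  ring

variable [Fintype V]

/-- The coefficient of a trivial path as a homomorphism of algebras. -/
noncomputable def nilCoordHom (a : V) : PathAlgebra k V →ₐ[k] k :=
  AlgHom.ofLinearMap (nilCoord k a)
    (by
      change nilCoord k a (unit k V) = 1
      rw [unit, map_sum, Finset.sum_eq_single a]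
      · simp [nilCoord_path, nilCoordPath]
      · intro b _ hb
        simp [nilCoord_path, nilCoordPath, hb.symm]
      · simp)
    (nilCoord_mulLin a)

theorem nilCoord_eq_zero {x : PathAlgebra k V} (hx : x ∈ arrowIdeal k V) (a : V) :
    nilCoord k a x = 0 := by
  unfold arrowIdeal at hx
  rw [TwoSidedIdeal.mem_asIdeal] at hx
  have h : TwoSidedIdeal.span {x : PathAlgebra k V | ∃ (a b : V) (e : a ⟶ b), x = path k e.toPath}
      ≤ TwoSidedIdeal.ker (nilCoordHom (k := k) a) := by
    rw [TwoSidedIdeal.span_le]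
    rintro _ ⟨b, c, e, rfl⟩
    rw [SetLike.mem_coe, TwoSidedIdeal.mem_ker]
    exact nilCoord_path a e.toPath
  exact (TwoSidedIdeal.mem_ker (nilCoordHom (k := k) a)).1 (h hx)

theorem nilCoord_eq_zero_of_mem_sq {x : PathAlgebra k V}
    (hx : x ∈ arrowIdeal k V * arrowIdeal k V) (a : V) : nilCoord k a x = 0 :=
  nilCoord_eq_zero (Ideal.mul_le_right hx) a

/-- In `arrowCoord_mulLin` each term contains a trivial-path coefficient of a factor, which vanishes
on `J`. -/
theorem arrowCoord_eq_zero_of_mem_sq {x : PathAlgebra k V}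
    (hx : x ∈ arrowIdeal k V * arrowIdeal k V) (i : Σ a b : V, (a ⟶ b)) :
    arrowCoord k i x = 0 := by
  induction hx using Submodule.mul_induction_on' with
  | mem_mul_mem m hm n hn =>
    rw [mul_def, arrowCoord_mulLin, nilCoord_eq_zero hm, nilCoord_eq_zero hn, zero_mul, mul_zero,
      add_zero]
  | add x hx y hy h h' => rw [map_add, h, h', add_zero]

end PathAlgebra

namespace RadSqZeroAlgebra

open PathAlgebra

variable {k V} [Fintype V]

/-- The coefficient of a trivial path in `kQ / J²`. -/
noncomputable def nilCoordHom (a : V) : RadSqZeroAlgebra k V →ₐ[k] k :=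
  Ideal.Quotient.liftₐ _ (PathAlgebra.nilCoordHom a) fun _ hx => nilCoord_eq_zero_of_mem_sq hx a

/-- The coefficient of an arrow in `kQ / J²`. -/
noncomputable def arrowCoord (i : Σ a b : V, (a ⟶ b)) : RadSqZeroAlgebra k V →ₗ[k] k :=
  ((arrowIdeal k V * arrowIdeal k V).restrictScalars k).liftQ (PathAlgebra.arrowCoord k i)
    fun _ hx => arrowCoord_eq_zero_of_mem_sq hx i

/-- The class of a path in `kQ / J²`. -/
noncomputable def mkPath {a b : V} (p : Quiver.Path a b) : RadSqZeroAlgebra k V :=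
  Ideal.Quotient.mk _ (path k p)

theorem nilCoordHom_mk (a : V) (x : PathAlgebra k V) :
    nilCoordHom a (Ideal.Quotient.mk (arrowIdeal k V * arrowIdeal k V) x) = nilCoord k a x :=
  rfl

theorem arrowCoord_mk (i : Σ a b : V, (a ⟶ b)) (x : PathAlgebra k V) :
    arrowCoord i (Ideal.Quotient.mk (arrowIdeal k V * arrowIdeal k V) x)
      = PathAlgebra.arrowCoord k i x :=
  rfl

theorem sum_coord_eq [∀ a b : V, Finite (a ⟶ b)] [Fintype (Σ a b : V, (a ⟶ b))]
    (r : RadSqZeroAlgebra k V) :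
    ∑ a, nilCoordHom a r • mkPath (k := k) (Quiver.Path.nil : Quiver.Path a a)
      + ∑ i, arrowCoord i r • mkPath (k := k) i.2.2.toPath = r := by
  obtain ⟨x, rfl⟩ := Ideal.Quotient.mk_surjective r
  simp only [nilCoordHom_mk, arrowCoord_mk]
  induction x using PathAlgebra.induction_path with
  | h0 => simp
  | hadd x y hx hy =>
    simp only [map_add, add_smul, Finset.sum_add_distrib]
    rw [add_add_add_comm, hx, hy]
  | hs s p =>
    have h1 : Ideal.Quotient.mk (arrowIdeal k V * arrowIdeal k V) (s • path k p)
        = s • mkPath p := rfl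
    rw [h1]
    simp only [map_smul, smul_eq_mul, mul_smul, ← Finset.smul_sum, ← smul_add, nilCoord_path,
      arrowCoord_path]
    congr 1
    cases p with
    | nil =>
      rename_i a
      rw [Finset.sum_eq_single a (fun b _ hb => by simp [nilCoordPath, hb]) (by simp)]
      simp [nilCoordPath, arrowCoordPath]
    | cons p e =>
      cases p with
      | nil => simp [nilCoordPath, arrowCoordPath]; rfl
      | cons p f =>
        have h2 : mkPath (k := k) ((p.cons f).cons e) = 0 :=
          mk_path_eq_zero k _ (by simp only [Quiver.Path.length_cons]; omega)
        rw [h2]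
        simp [nilCoordPath, arrowCoordPath]

variable (k V)

/-- The opposite of `kQ / J²`, described by the trivial paths and the arrows. -/
noncomputable def arrowPresentation [∀ a b : V, Finite (a ⟶ b)] [Fintype (Σ a b : V, (a ⟶ b))] :
    ArrowPresentation k (RadSqZeroAlgebra k V)ᵐᵒᵖ V (Σ a b : V, (a ⟶ b)) where
  source i := i.1
  target i := i.2.1
  e a := MulOpposite.op (mkPath (Quiver.Path.nil : Quiver.Path a a))
  x i := MulOpposite.op (mkPath i.2.2.toPath)
  c a := AlgHom.fromOpposite (nilCoordHom a) fun _ _ => mul_comm _ _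
  d i := (arrowCoord i).comp (MulOpposite.opLinearEquiv k).symm.toLinearMap
  sum_eq r := by
    conv_rhs => rw [← MulOpposite.op_unop r, ← sum_coord_eq r.unop]
    simp only [MulOpposite.op_add, Finset.op_sum, MulOpposite.op_smul]
    rfl
  c_e a b := by
    exact nilCoord_path a _
  c_x a i := nilCoord_path a _
  d_e i a := arrowCoord_path i _
  d_x i j := by
    refine (arrowCoord_path i _).trans ?_
    simp only [Quiver.Hom.toPath, arrowCoordPath]
    congr
  d_mul i r s := by
    obtain ⟨x, hx⟩ := Ideal.Quotient.mk_surjective r.unop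
    obtain ⟨y, hy⟩ := Ideal.Quotient.mk_surjective s.unop
    obtain rfl : r = MulOpposite.op (Ideal.Quotient.mk _ x) := by rw [hx, MulOpposite.op_unop]
    obtain rfl : s = MulOpposite.op (Ideal.Quotient.mk _ y) := by rw [hy, MulOpposite.op_unop]
    -- The product `r * s` in the opposite ring is the class of `y * x`, so the target of an arrow
    -- acts on its left.
    change PathAlgebra.arrowCoord k i (mulLin k y x) = nilCoord k i.2.1 x
      * PathAlgebra.arrowCoord k i y + PathAlgebra.arrowCoord k i x * nilCoord k i.1 y
    rw [arrowCoord_mulLin]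
    ring

end RadSqZeroAlgebra

end Concrete

namespace ArrowPresentation

open IgusaTodorov

/-! ### Multiplication in coordinates, self-injectivity, arrow ideals -/

section Ring

variable {k : Type*} [Field k] {R : Type u} [Ring R] [Algebra k R] {V E : Type*} [Fintype V]
  [Fintype E] (p : ArrowPresentation k R V E)

theorem ext_coord {r s : R} (hc : ∀ a, p.c a r = p.c a s) (hd : ∀ i, p.d i r = p.d i s) :
    r = s := by
  rw [← p.sum_eq r, ← p.sum_eq s]
  simp only [hc, hd]

/-- Products of arrows vanish, so only the trivial part of `r` at the target survives. Hence the
left ideal of an arrow is a line over `k`. -/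
theorem mul_x (r : R) (i : E) : r * p.x i = p.c (p.target i) r • p.x i := by
  refine p.ext_coord (fun a => ?_) fun j => ?_
  · simp [p.c_x]
  · rw [p.d_mul, map_smul, p.d_x, p.c_x, mul_zero, add_zero, smul_eq_mul]
    split_ifs with h
    · rw [h]
    · simp

theorem x_mul (r : R) (i : E) : p.x i * r = p.c (p.source i) r • p.x i := by
  refine p.ext_coord (fun a => ?_) fun j => ?_
  · simp [p.c_x]
  · rw [p.d_mul, map_smul, p.d_x, p.c_x, zero_mul, zero_add, smul_eq_mul]
    split_ifs with h
    · rw [h, mul_comm]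
    · simp

theorem x_ne_zero (i : E) : p.x i ≠ 0 := fun h => by
  have := p.d_x i i
  simp [h] at this

theorem d_one (i : E) : p.d i 1 = 0 := by
  have h := p.d_mul i 1 1
  rw [map_one (p.c _), map_one (p.c _), one_mul, mul_one, one_mul] at h
  exact left_eq_add.1 h

theorem sum_e : ∑ a, p.e a = 1 := by
  classical
  refine p.ext_coord (fun a => ?_) fun i => ?_
  · rw [map_sum, map_one, Finset.sum_eq_single a (fun b _ hb => by simp [p.c_e, hb.symm]) (by simp),
      p.c_e, if_pos rfl]
  · simp [p.d_e, p.d_one]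

theorem c_e_self (a : V) : p.c a (p.e a) = 1 := by simp [p.c_e]

theorem e_mul_e_self (a : V) : p.e a * p.e a = p.e a := by
  refine p.ext_coord (fun b => ?_) fun i => ?_
  · simp [p.c_e]
  · simp [p.d_mul, p.d_e]

theorem e_mul_of_not_target {b : V} (h : ∀ i, p.target i ≠ b) (r : R) :
    p.e b * r = p.c b r • p.e b := by
  refine p.ext_coord (fun a => ?_) fun i => ?_
  · by_cases hab : a = b
    · subst hab; simp [p.c_e]
    · simp [p.c_e, hab]
  · simp [p.d_mul, p.d_e, p.c_e, h i]

theorem mul_e_of_not_source {b : V} (h : ∀ i, p.source i ≠ b) (r : R) :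
    r * p.e b = p.c b r • p.e b := by
  refine p.ext_coord (fun a => ?_) fun i => ?_
  · by_cases hab : a = b
    · subst hab; simp [p.c_e]
    · simp [p.c_e, hab]
  · simp [p.d_mul, p.d_e, p.c_e, h i]

/-- All trivial coefficients of `r * e b` vanish: at `b` by hypothesis, elsewhere because `c a (e b)
= 0`. -/
theorem mul_e_eq_sum {b : V} {r : R} (h : p.c b r = 0) :
    r * p.e b = ∑ i, p.d i (r * p.e b) • p.x i := by
  conv_lhs => rw [← p.sum_eq (r * p.e b)]
  rw [Finset.sum_eq_zero, zero_add]
  intro a _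
  rw [map_mul, p.c_e]
  split_ifs with hab
  · rw [hab, h, zero_mul, zero_smul]
  · rw [mul_zero, zero_smul]

/-- If arrows have distinct targets and no target is a sink, the ring is self-injective. -/
theorem injective_self [Module.Finite k R] (hsink : ∀ i, ∃ j, p.source j = p.target i)
    (htarget : Function.Injective p.target) : Module.Injective R R := by
  classical
  -- A Frobenius form: the sum of all arrow coefficients and of the coefficients of `e b` at
  -- non-sources `b`. By `hsink` such a `b` is not a target either, so it is isolated.
  let l : R →ₗ[k] k :=
    ∑ b with ∀ i, p.source i ≠ b, (p.c b).toLinearMap + ∑ i, p.d i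
  have hl : ∀ r, l r = ∑ b with ∀ i, p.source i ≠ b, p.c b r + ∑ i, p.d i r := fun r => by
    simp [l]
  let B : R →ₗ[k] R →ₗ[k] k := (LinearMap.mul k R).flip.compr₂ l
  have hB : ∀ c r, B c r = l (r * c) := fun c r => rfl
  have hlx : ∀ i, l (p.x i) = 1 := fun i => by simp [hl, p.c_x, p.d_x]
  -- Nondegeneracy. Testing against `x i` removes the trivial coefficients at sources, against `e b`
  -- those at isolated vertices, and against `e (target i)` the coefficient `d i`, isolated because
  -- targets are distinct.
  have hker : ∀ y, (∀ r, l (r * y) = 0) → y = 0 := by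
    intro y hy
    have h1 : ∀ i, p.c (p.source i) y = 0 := fun i => by
      have := hy (p.x i)
      rwa [p.x_mul, map_smul, hlx, smul_eq_mul, mul_one] at this
    refine p.ext_coord (fun b => ?_) fun i => ?_
    · rw [map_zero]
      by_cases hb : ∀ i, p.source i ≠ b
      · have h2 : ∀ i, p.target i ≠ b := fun i hi => by
          obtain ⟨j, hj⟩ := hsink i
          exact hb j (hj.trans hi)
        have := hy (p.e b)
        rw [p.e_mul_of_not_target h2, map_smul, hl] at this
        simpa [p.c_e, p.d_e, Finset.sum_ite_eq', hb] using this
      · push Not at hb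
        obtain ⟨i, rfl⟩ := hb
        exact h1 i
    · rw [map_zero]
      have h2 := hy (p.e (p.target i))
      rw [hl, Finset.sum_eq_zero, zero_add, Finset.sum_eq_single i] at h2
      · simpa [p.d_mul, p.c_e, p.d_e] using h2
      · intro j _ hj
        simp [p.d_mul, p.c_e, p.d_e, htarget.ne hj]
      · simp
      · intro b hb
        obtain ⟨j, hj⟩ := hsink i
        have : b ≠ p.target i := fun h => (Finset.mem_filter.1 hb).2 j (hj.trans h.symm)
        simp [p.c_e, this]
  have hsurj : Function.Surjective B := by
    have hinj : Function.Injective B := by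
      rw [injective_iff_map_eq_zero]
      exact fun y hy => hker y fun r => by rw [← hB, hy, LinearMap.zero_apply]
    exact (LinearMap.injective_iff_surjective_of_finrank_eq_finrank
      (Subspace.dual_finrank_eq (K := k) (V := R)).symm).1 hinj
  -- Baer's criterion: the functional `l ∘ f` on `I` extends to `R` and has the form `l (· * y)`.
  -- Nondegeneracy then upgrades this to `f r = r * y`.
  refine Module.Baer.injective fun I f => ?_
  let I' : Submodule k R := I.restrictScalars k
  obtain ⟨g, hg⟩ := LinearMap.exists_extend (p := I') (l ∘ₗ (f.restrictScalars k : I' →ₗ[k] R))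
  obtain ⟨y, rfl⟩ := hsurj g
  refine ⟨LinearMap.toSpanSingleton R R y, fun r hr => ?_⟩
  have key : ∀ (s : R) (hs : s ∈ I), l (f ⟨s, hs⟩) = l (s * y) := fun s hs =>
    (LinearMap.congr_fun hg ⟨s, hs⟩).symm
  refine (sub_eq_zero.1 (hker (f ⟨r, hr⟩ - r * y) fun s => ?_)).symm
  rw [mul_sub, map_sub, ← mul_assoc, ← key (s * r) (I.mul_mem_left s hr), sub_eq_zero,
    ← smul_eq_mul, ← map_smul]
  rfl

/-- The left ideal spanned by a set of arrows. -/
def arrowSpan (T : Set E) : Submodule R R :=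
  Submodule.span R (p.x '' T)

theorem x_mem_arrowSpan {T : Set E} {i : E} (hi : i ∈ T) : p.x i ∈ p.arrowSpan T :=
  Submodule.subset_span ⟨i, hi, rfl⟩

theorem c_eq_zero_of_mem_arrowSpan {T : Set E} {r : R} (hr : r ∈ p.arrowSpan T) (a : V) :
    p.c a r = 0 := by
  unfold arrowSpan at hr
  induction hr using Submodule.span_induction with
  | mem r hr => obtain ⟨i, -, rfl⟩ := hr; exact p.c_x a i
  | zero => exact map_zero _
  | add r s _ _ hr hs => rw [map_add, hr, hs, add_zero]
  | smul r s _ hs => rw [smul_eq_mul, map_mul, hs, mul_zero]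

theorem d_eq_zero_of_mem_arrowSpan {T : Set E} {r : R} (hr : r ∈ p.arrowSpan T) {i : E}
    (hi : i ∉ T) : p.d i r = 0 := by
  have hc := fun (s : R) (hs : s ∈ p.arrowSpan T) => p.c_eq_zero_of_mem_arrowSpan hs
  unfold arrowSpan at hr hc
  induction hr using Submodule.span_induction with
  | mem r hr =>
    obtain ⟨j, hj, rfl⟩ := hr
    rw [p.d_x, if_neg]
    rintro rfl
    exact hi hj
  | zero => exact map_zero _
  | add r s _ _ hr hs => rw [map_add, hr, hs, add_zero]
  | smul r s hs' hs => rw [smul_eq_mul, p.d_mul, hs, mul_zero, hc s hs', mul_zero, add_zero]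

theorem x_notMem_arrowSpan {T : Set E} {i : E} (hi : i ∉ T) : p.x i ∉ p.arrowSpan T := fun h => by
  have := p.d_eq_zero_of_mem_arrowSpan h hi
  simp [p.d_x] at this

theorem disjoint_arrowSpan {S T : Set E} (h : Disjoint S T) :
    Disjoint (p.arrowSpan S) (p.arrowSpan T) := by
  rw [Submodule.disjoint_def]
  intro r hS hT
  refine p.ext_coord (fun a => ?_) fun i => ?_
  · rw [p.c_eq_zero_of_mem_arrowSpan hS, map_zero]
  · rw [map_zero]
    by_cases hi : i ∈ S
    · exact p.d_eq_zero_of_mem_arrowSpan hT (Set.disjoint_left.1 h hi)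
    · exact p.d_eq_zero_of_mem_arrowSpan hS hi

/-- Arrow ideals of disjoint sets of arrows form a direct sum. -/
noncomputable def arrowSpanUnionEquiv {S T : Set E} (h : Disjoint S T) :
    p.arrowSpan (S ∪ T) ≃ₗ[R] p.arrowSpan S × p.arrowSpan T :=
  let f := (p.arrowSpan S).subtype.coprod (p.arrowSpan T).subtype
  have hf : Function.Injective f := by
    rw [← LinearMap.ker_eq_bot, LinearMap.ker_coprod_of_disjoint_range]
    · simp
    · simpa using p.disjoint_arrowSpan h
  (LinearEquiv.ofEq _ _ (by
    rw [LinearMap.range_coprod, Submodule.range_subtype, Submodule.range_subtype, arrowSpan,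
      Set.image_union, Submodule.span_union]
    rfl)).trans
    (LinearEquiv.ofInjective f hf).symm

end Ring

/-! ### Simple modules at the vertices -/

section Simple

variable {k : Type*} [Field k] {R : Type u} [Ring R] [Algebra k R] {V E : Type*} [Fintype V]
  [Fintype E] (p : ArrowPresentation k R V E)

/-- The left ideal of elements with vanishing coefficient at `a`. -/
def vertexIdeal (a : V) : Submodule R R :=
  RingHom.ker (p.c a)

/-- The simple module at the vertex `a`. -/
def simple (a : V) : FGModuleCat.{u} R :=
  FGModuleCat.of R (R ⧸ p.vertexIdeal a)

/-- The generator of the simple module at `a`. -/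
def simpleGen (a : V) : p.simple a :=
  Submodule.Quotient.mk (p := p.vertexIdeal a) (1 : R)

theorem smul_simpleGen (a : V) (r : R) :
    r • p.simpleGen a = Submodule.Quotient.mk (p := p.vertexIdeal a) r := by
  change Submodule.Quotient.mk (p := p.vertexIdeal a) (r * 1) = _
  rw [mul_one]

theorem exists_smul_simpleGen {a : V} (y : p.simple a) : ∃ r : R, r • p.simpleGen a = y := by
  obtain ⟨r, rfl⟩ := Submodule.mkQ_surjective (p.vertexIdeal a) y
  exact ⟨r, p.smul_simpleGen a r⟩

theorem smul_simpleGen_eq_zero {a : V} {r : R} : r • p.simpleGen a = 0 ↔ p.c a r = 0 := by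
  rw [smul_simpleGen]
  exact Submodule.Quotient.mk_eq_zero _

theorem smul_simple_eq_zero {a : V} {r : R} (hr : p.c a r = 0) (y : p.simple a) : r • y = 0 := by
  obtain ⟨s, rfl⟩ := p.exists_smul_simpleGen y
  rw [← mul_smul, smul_simpleGen_eq_zero, map_mul, hr, zero_mul]

theorem e_smul_simple {a : V} (y : p.simple a) : p.e a • y = y := by
  have h : (p.e a - 1) • y = 0 := p.smul_simple_eq_zero (by simp [p.c_e]) y
  rwa [sub_smul, one_smul, sub_eq_zero] at h

instance isSimpleModule_simple (a : V) : IsSimpleModule R (p.simple a) := by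
  have h : (RingHom.ker (p.c a)).IsMaximal :=
    RingHom.ker_isMaximal_of_surjective (p.c a) fun t => ⟨algebraMap k R t, by simp⟩
  exact isSimpleModule_iff_isCoatom.2 (Ideal.isMaximal_def.1 h)

variable {M : Type*} [AddCommGroup M] [Module R M]

/-- The homomorphism from the simple module at `b` given by an element annihilated by the ideal
of `b`. -/
def simpleLift {b : V} (y : M) (hy : ∀ r, p.c b r = 0 → r • y = 0) : p.simple b →ₗ[R] M :=
  (p.vertexIdeal b).liftQ (LinearMap.toSpanSingleton R M y) fun r hr => hy r hr

theorem simpleLift_smul_gen {b : V} (y : M) (hy : ∀ r, p.c b r = 0 → r • y = 0) (r : R) :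
    p.simpleLift y hy (r • p.simpleGen b) = r • y := by
  rw [map_smul]
  congr 1
  exact (Submodule.liftQ_apply _ _ _).trans (one_smul R y)

theorem simpleLift_injective {b : V} {y : M} (hy : ∀ r, p.c b r = 0 → r • y = 0) (h0 : y ≠ 0) :
    Function.Injective (p.simpleLift y hy) := by
  refine LinearMap.injective_of_ne_zero fun h => h0 ?_
  have := p.simpleLift_smul_gen y hy 1
  rw [h, LinearMap.zero_apply, one_smul] at this
  exact this.symm

theorem range_simpleLift {b : V} {y : M} (hy : ∀ r, p.c b r = 0 → r • y = 0) :
    LinearMap.range (p.simpleLift y hy) = Submodule.span R {y} := by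
  refine le_antisymm ?_ ?_
  · rintro _ ⟨z, rfl⟩
    obtain ⟨r, rfl⟩ := p.exists_smul_simpleGen z
    rw [simpleLift_smul_gen]
    exact Submodule.smul_mem _ _ (Submodule.mem_span_singleton_self y)
  · rw [Submodule.span_singleton_le_iff_mem]
    exact ⟨p.simpleGen b, by simpa using p.simpleLift_smul_gen y hy 1⟩

/-- A nonzero element annihilated by the ideal of `b` spans a copy of the simple module. -/
noncomputable def simpleEquivSpan {b : V} {y : M} (hy : ∀ r, p.c b r = 0 → r • y = 0)
    (h0 : y ≠ 0) : p.simple b ≃ₗ[R] Submodule.span R {y} :=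
  (LinearEquiv.ofInjective _ (p.simpleLift_injective hy h0)).trans
    (LinearEquiv.ofEq _ _ (p.range_simpleLift hy))

/-- As `y = e b • y`, the element `r` acts through `r * e b`, a combination of arrows. -/
theorem smul_eq_zero_of_e_smul {b : V} {y : M} (hx : ∀ i, p.x i • y = 0) (he : p.e b • y = y)
    (r : R) (hr : p.c b r = 0) : r • y = 0 := by
  rw [← he, ← mul_smul, p.mul_e_eq_sum hr, Finset.sum_smul]
  refine Finset.sum_eq_zero fun i _ => ?_
  rw [Algebra.smul_def, mul_smul, hx, smul_zero]

theorem e_smul_e_smul (b : V) (y : M) : p.e b • p.e b • y = p.e b • y := by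
  rw [← mul_smul, e_mul_e_self]

theorem sum_e_smul (y : M) : ∑ a, p.e a • y = y := by
  rw [← Finset.sum_smul, sum_e, one_smul]

theorem x_smul_smul {i : E} {y : M} (hy : p.x i • y = 0) (r : R) : p.x i • r • y = 0 := by
  rw [← mul_smul, x_mul, Algebra.smul_def, mul_smul, hy, smul_zero]

/-- A module annihilated by the arrows is semisimple. -/
theorem isSemisimpleModule_of_x_smul (h : ∀ (i : E) (y : M), p.x i • y = 0) :
    IsSemisimpleModule R M := by
  -- Every `y` is the sum of the `e a • y`, and each nonzero one spans a copy of the simple module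
  -- at `a`.
  refine isSemisimpleModule_of_isSemisimpleModule_submodule'
    (p := fun z : {z : V × M // p.e z.1 • z.2 ≠ 0} => Submodule.span R {p.e z.1.1 • z.1.2})
    (fun z => ?_) ?_
  · exact IsSemisimpleModule.congr (p.simpleEquivSpan (p.smul_eq_zero_of_e_smul (h · _)
      (p.e_smul_e_smul z.1.1 z.1.2)) z.2).symm
  · rw [eq_top_iff]
    rintro y -
    rw [← p.sum_e_smul y]
    refine sum_mem fun a _ => ?_
    by_cases h0 : p.e a • y = 0
    · rw [h0]
      exact zero_mem _
    · exact Submodule.mem_iSup_of_mem ⟨(a, y), h0⟩ (Submodule.mem_span_singleton_self _)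

/-- If `x i • y` were nonzero it would generate `M`, so `y = r • x i • y` and `x i • y = (x i * r *
x i) • y = 0`. -/
theorem x_smul_eq_zero [IsSimpleModule R M] (i : E) (y : M) : p.x i • y = 0 := by
  by_contra h
  have hmem : y ∈ Submodule.span R {p.x i • y} := by
    rw [IsSimpleModule.span_singleton_eq_top R h]; trivial
  obtain ⟨r, hr⟩ := Submodule.mem_span_singleton.1 hmem
  refine h ?_
  conv_lhs => rw [← hr]
  rw [← mul_smul, ← mul_smul, p.mul_x (p.x i * r), map_mul, p.c_x, zero_mul, zero_smul, zero_smul]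

theorem nonempty_equiv_simple [IsSimpleModule R M] {b : V} {y : M} (h : p.e b • y ≠ 0) :
    Nonempty (M ≃ₗ[R] p.simple b) := by
  have e := p.simpleEquivSpan (p.smul_eq_zero_of_e_smul (p.x_smul_eq_zero · _)
    (p.e_smul_e_smul b y)) h
  rw [IsSimpleModule.span_singleton_eq_top R h] at e
  exact ⟨Submodule.topEquiv.symm.trans e.symm⟩

theorem exists_e_smul_ne_zero [Nontrivial M] : ∃ (b : V) (y : M), p.e b • y ≠ 0 := by
  obtain ⟨y, hy⟩ := exists_ne (0 : M)
  by_contra! h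
  exact hy (by rw [← p.sum_e_smul y]; exact Finset.sum_eq_zero fun a _ => h a y)

/-- The left ideal spanned by an arrow is the simple module at its target. -/
noncomputable def simpleEquivArrowSpan (i : E) :
    p.simple (p.target i) ≃ₗ[R] p.arrowSpan {i} :=
  (p.simpleEquivSpan (fun r hr => by rw [smul_eq_mul, mul_x, hr, zero_smul])
    (p.x_ne_zero i)).trans (LinearEquiv.ofEq _ _ (by rw [arrowSpan, Set.image_singleton]))

/-- The simple module at a sink is projective. -/
theorem projective_simple {b : V} (h : ∀ i, p.source i ≠ b) :
    Module.Projective R (p.simple b) := by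
  refine Module.Projective.of_split (M := R) (p.simpleLift (p.e b) fun r hr => by
      rw [smul_eq_mul, p.mul_e_of_not_source h, hr, zero_smul])
    (LinearMap.toSpanSingleton R _ (p.simpleGen b)) ?_
  refine LinearMap.ext fun y => ?_
  obtain ⟨r, rfl⟩ := p.exists_smul_simpleGen y
  rw [LinearMap.comp_apply, simpleLift_smul_gen, LinearMap.toSpanSingleton_apply, smul_assoc,
    e_smul_simple, LinearMap.id_apply]

/-- The simple module at a source is injective. -/
theorem injective_simple {b : V} (h : ∀ i, p.target i ≠ b) :
    Module.Injective R (p.simple b) := by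
  refine Module.Baer.injective fun I f => ?_
  have hf : ∀ (r : R) (hr : r ∈ I),
      f ⟨r, hr⟩ = f ⟨p.e b * r, I.mul_mem_left _ hr⟩ := fun r hr => by
    rw [← p.e_smul_simple (f ⟨r, hr⟩), ← map_smul]; rfl
  -- Since `e b * r = c b r • e b`, either `I` contains `e b`, whose image determines `f`, or `e b`
  -- annihilates `I` and `f = 0`.
  by_cases hI : ∃ r ∈ I, p.c b r ≠ 0
  · obtain ⟨s, hs, hs0⟩ := hI
    have he : p.e b ∈ I := by
      have h1 : (algebraMap k R (p.c b s)⁻¹ * p.e b) * s = p.e b := by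
        rw [mul_assoc, p.e_mul_of_not_target h, ← Algebra.smul_def, smul_smul,
          inv_mul_cancel₀ hs0, one_smul]
      rw [← h1]
      exact I.mul_mem_left _ hs
    refine ⟨LinearMap.toSpanSingleton R _ (f ⟨p.e b, he⟩), fun r hr => ?_⟩
    have h2 : (⟨p.e b * r, I.mul_mem_left _ hr⟩ : I)
        = algebraMap k R (p.c b r) • (⟨p.e b, he⟩ : I) := by
      refine Subtype.ext ?_
      change p.e b * r = algebraMap k R (p.c b r) * p.e b
      rw [p.e_mul_of_not_target h, Algebra.smul_def]
    rw [hf r hr, h2, map_smul, LinearMap.toSpanSingleton_apply, ← sub_eq_zero, ← sub_smul]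
    exact p.smul_simple_eq_zero (by simp) _
  · push Not at hI
    refine ⟨0, fun r hr => ?_⟩
    have h2 : (⟨p.e b * r, I.mul_mem_left _ hr⟩ : I) = 0 := by
      refine Subtype.ext ?_
      change p.e b * r = 0
      rw [p.e_mul_of_not_target h, hI r hr, zero_smul]
    rw [hf r hr, h2, map_zero, LinearMap.zero_apply]

/-- The simple module at the target of an arrow is not injective. -/
theorem not_injective_simple (i : E) : ¬ Module.Injective R (p.simple (p.target i)) := by
  intro h
  -- An extension `g` to `R` of the isomorphism from the ideal of `x i` would send `x i` to `x i • g
  -- 1 = 0`.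
  obtain ⟨g, hg⟩ := h.out (p.arrowSpan {i}).subtype (Submodule.subtype_injective _)
    (p.simpleEquivArrowSpan i).symm.toLinearMap
  have hx := p.x_mem_arrowSpan (Set.mem_singleton i)
  have h1 := hg ⟨p.x i, hx⟩
  have h2 : g (p.x i) = 0 := by
    rw [← mul_one (p.x i), ← smul_eq_mul, map_smul]
    exact p.smul_simple_eq_zero (p.c_x _ i) _
  rw [Submodule.subtype_apply, h2] at h1
  have h3 : (⟨p.x i, hx⟩ : p.arrowSpan {i}) = 0 :=
    (LinearEquiv.map_eq_zero_iff _).1 h1.symm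
  exact p.x_ne_zero i (congrArg Subtype.val h3)

end Simple

end ArrowPresentation

/-! ### Invariants of `K₀`, syzygies of cyclic modules, sums of simples -/

namespace IgusaTodorov

variable {R : Type u} [Ring R]

/-- The homomorphism from `K₀` given by an additive invariant that vanishes on projectives. -/
noncomputable def K0.lift {G : Type*} [AddCommGroup G] (F : FGModuleCat.{u} R → G)
    (hcongr : ∀ M N : FGModuleCat.{u} R, Nonempty (M ≃ₗ[R] N) → F M = F N)
    (hprod : ∀ M N : FGModuleCat.{u} R, F (FGModuleCat.of R (M × N)) = F M + F N)
    (hproj : ∀ P : FGModuleCat.{u} R, Module.Projective R P → F P = 0) : K0 R →+ G :=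
  QuotientAddGroup.lift (relations R)
    (FreeAbelianGroup.lift fun c : IsoClass R => Quotient.lift (s := isoSetoid R) F hcongr c)
    (by
      unfold relations
      rw [AddSubgroup.closure_le]
      rintro x (⟨M, M', M'', e⟩ | ⟨P, hP⟩)
      · simp only [SetLike.mem_coe, AddMonoidHom.mem_ker, symbol, map_sub,
          FreeAbelianGroup.lift_apply_of]
        change F M - F M' - F M'' = 0
        rw [hcongr M (FGModuleCat.of R (M' × M'')) e, hprod]
        abel
      · simp only [SetLike.mem_coe, AddMonoidHom.mem_ker, symbol,
          FreeAbelianGroup.lift_apply_of]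
        exact hproj P hP)

theorem K0.lift_mk {G : Type*} [AddCommGroup G] (F : FGModuleCat.{u} R → G)
    (hcongr : ∀ M N : FGModuleCat.{u} R, Nonempty (M ≃ₗ[R] N) → F M = F N)
    (hprod : ∀ M N : FGModuleCat.{u} R, F (FGModuleCat.of R (M × N)) = F M + F N)
    (hproj : ∀ P : FGModuleCat.{u} R, Module.Projective R P → F P = 0)
    (M : FGModuleCat.{u} R) : K0.lift F hcongr hprod hproj (K0.mk M) = F M := by
  change FreeAbelianGroup.lift _ (symbol M) = _
  rw [symbol, FreeAbelianGroup.lift_apply_of]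
  rfl

/-- The map `R → R ⧸ L` need not be a projective cover; by Schanuel's lemma the class of the kernel
does not depend on the projective presentation. -/
theorem omegaBar_mk_quotient [IsArtinianRing R] (L : Submodule R R) :
    omegaBar R (K0.mk (FGModuleCat.of R (R ⧸ L))) = K0.mk (FGModuleCat.of R L) := by
  rw [omegaBar_mk, mk_syzygy (P := FGModuleCat.of R R) (M := FGModuleCat.of R (R ⧸ L))
    (inferInstanceAs (Module.Projective R R)) L.mkQ L.mkQ_surjective]
  exact K0.mk_congr (LinearEquiv.ofEq _ _ L.ker_mkQ)

/-- The kernel of a projective cover is annihilated by all homomorphisms to simple modules. -/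
theorem IsProjectiveCover.apply_eq_zero {P M : Type v} [AddCommGroup P] [Module R P]
    [AddCommGroup M] [Module R M] {f : P →ₗ[R] M} (hf : IsProjectiveCover f) {T : Type*}
    [AddCommGroup T] [Module R T] [IsSimpleModule R T] (g : P →ₗ[R] T) {z : P} (hz : f z = 0) :
    g z = 0 := by
  rcases LinearMap.surjective_or_eq_zero g with hg | rfl
  · have hc := LinearMap.isCoatom_ker_of_surjective hg
    -- The kernel of `g` is maximal, so if it missed `z` it would span `P` together with `ker f`,
    -- against superfluousness.
    by_contra h
    have h1 : LinearMap.ker g < LinearMap.ker g ⊔ LinearMap.ker f :=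
      lt_of_le_of_ne le_sup_left fun h2 => h (by
        have h3 : z ∈ LinearMap.ker g ⊔ LinearMap.ker f := Submodule.mem_sup_right hz
        rwa [← h2] at h3)
    exact hc.1 (hf.superfluous _ (hc.2 _ h1))
  · rfl

theorem isSummand_directSum {m : ℕ} (S : Fin m → FGModuleCat.{u} R) (l : Fin m) :
    IsSummand (S l) (directSum S) :=
  ⟨FGModuleCat.of R (∀ j : {j // j ≠ l}, S j),
    ⟨{ Equiv.piSplitAt l fun j => S j with
      map_add' := fun _ _ => rfl
      map_smul' := fun _ _ => rfl }⟩⟩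

/-- The indecomposable summands of a direct sum of simple modules are its terms. -/
theorem addSpan_directSum_eq {m : ℕ} (S : Fin m → FGModuleCat.{u} R)
    (hS : ∀ l, IsSimpleModule R (S l)) :
    addSpan (directSum S) = AddSubgroup.closure (Set.range fun l => K0.mk (S l)) := by
  refine le_antisymm ?_ ?_
  · refine AddSubgroup.closure_mono ?_
    rintro _ ⟨T, hT, hTS, rfl⟩
    obtain ⟨f, hf⟩ := hTS.exists_injective
    have hss : IsSemisimpleModule R (directSum S) :=
      inferInstanceAs (IsSemisimpleModule R (∀ l, S l))
    have := IsSemisimpleModule.of_injective f hf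
    have hsimple := hT.isSimpleModule
    obtain ⟨y, hy⟩ := @exists_ne T hT.1 0
    have hfy : f y ≠ 0 := fun h => hy (hf (h.trans (map_zero f).symm))
    -- Some coordinate of the embedding is nonzero, hence an isomorphism by Schur's lemma.
    obtain ⟨l, hl⟩ := Function.ne_iff.1 hfy
    let g : T →ₗ[R] S l := (LinearMap.proj (R := R) (φ := fun l => S l) l).comp f
    have hg : g ≠ 0 := fun h => hl (LinearMap.congr_fun h y)
    exact ⟨l, (K0.mk_congr (LinearEquiv.ofBijective g (LinearMap.bijective_of_ne_zero hg))).symm⟩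
  · rw [AddSubgroup.closure_le]
    rintro _ ⟨l, rfl⟩
    exact AddSubgroup.subset_closure
      ⟨S l, indecomposable_of_isSimpleModule _, isSummand_directSum S l, rfl⟩

end IgusaTodorov

/-- The product of two submodules as a module. -/
def Submodule.prodLinearEquiv {R M N : Type*} [Ring R] [AddCommGroup M] [Module R M]
    [AddCommGroup N] [Module R N] (K : Submodule R M) (L : Submodule R N) :
    K.prod L ≃ₗ[R] K × L where
  toFun x := (⟨x.1.1, x.2.1⟩, ⟨x.1.2, x.2.2⟩)
  invFun y := ⟨(y.1.1, y.2.1), ⟨y.1.2, y.2.2⟩⟩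
  map_add' _ _ := rfl
  map_smul' _ _ := rfl
  left_inv _ := rfl
  right_inv _ := rfl

namespace ArrowPresentation

open IgusaTodorov

variable {k : Type*} [Field k] {R : Type u} [Ring R] [Algebra k R] {V E : Type*} [Fintype V]
  [Fintype E] (p : ArrowPresentation k R V E)

/-! ### Multiplicity of a simple summand -/

section Multiplicity

variable (M N : Type*) [AddCommGroup M] [Module R M] [AddCommGroup N] [Module R N]

/-- The elements annihilated by all arrows. -/
def arrowSocle : Submodule R M where
  carrier := {y | ∀ i, p.x i • y = 0}
  add_mem' hy hz i := by rw [smul_add, hy i, hz i, add_zero]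
  zero_mem' i := smul_zero _
  smul_mem' r _ hy i := p.x_smul_smul (hy i) r

/-- The elements annihilated by all arrows and by all homomorphisms to the simple module at `a`. -/
def arrowSocleRad (a : V) : Submodule R M :=
  p.arrowSocle M ⊓ ⨅ f : M →ₗ[R] p.simple a, LinearMap.ker f

variable {M N}

theorem mem_arrowSocle {y : M} : y ∈ p.arrowSocle M ↔ ∀ i, p.x i • y = 0 := Iff.rfl

theorem mem_arrowSocleRad {a : V} {y : M} : y ∈ p.arrowSocleRad M a ↔
    (∀ i, p.x i • y = 0) ∧ ∀ f : M →ₗ[R] p.simple a, f y = 0 := by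
  simp [arrowSocleRad, mem_arrowSocle]

theorem map_arrowSocle (e : M ≃ₗ[R] N) :
    (p.arrowSocle M).map e.toLinearMap = p.arrowSocle N := by
  ext y
  rw [Submodule.mem_map_equiv, mem_arrowSocle, mem_arrowSocle]
  refine forall_congr' fun i => ?_
  rw [← map_smul, LinearEquiv.map_eq_zero_iff]

theorem map_arrowSocleRad (e : M ≃ₗ[R] N) (a : V) :
    (p.arrowSocleRad M a).map e.toLinearMap = p.arrowSocleRad N a := by
  ext y
  rw [Submodule.mem_map_equiv, mem_arrowSocleRad, mem_arrowSocleRad]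
  refine and_congr (forall_congr' fun i => ?_) ⟨fun h f => ?_, fun h f => h (f ∘ₗ e.symm)⟩
  · rw [← map_smul, LinearEquiv.map_eq_zero_iff]
  · simpa using h (f ∘ₗ e)

theorem arrowSocle_prod : p.arrowSocle (M × N) = (p.arrowSocle M).prod (p.arrowSocle N) := by
  ext y
  simp only [mem_arrowSocle, Submodule.mem_prod, ← forall_and, Prod.ext_iff, Prod.smul_fst,
    Prod.smul_snd, Prod.fst_zero, Prod.snd_zero]

theorem arrowSocleRad_prod (a : V) :
    p.arrowSocleRad (M × N) a = (p.arrowSocleRad M a).prod (p.arrowSocleRad N a) := by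
  ext y
  simp only [mem_arrowSocleRad, Submodule.mem_prod]
  constructor
  · rintro ⟨h1, h2⟩
    exact ⟨⟨fun i => congrArg Prod.fst (h1 i), fun f => h2 (f ∘ₗ LinearMap.fst R M N)⟩,
      ⟨fun i => congrArg Prod.snd (h1 i), fun f => h2 (f ∘ₗ LinearMap.snd R M N)⟩⟩
  · rintro ⟨⟨h1, h2⟩, h3, h4⟩
    refine ⟨fun i => Prod.ext (h1 i) (h3 i), fun f => ?_⟩
    have h5 : y = LinearMap.inl R M N y.1 + LinearMap.inr R M N y.2 := by ext <;> simp
    rw [h5, map_add]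
    have h6 := h2 (f ∘ₗ LinearMap.inl R M N)
    have h7 := h4 (f ∘ₗ LinearMap.inr R M N)
    rw [LinearMap.comp_apply] at h6 h7
    rw [h6, h7, add_zero]

/-- The multiplicity of the simple module at `a` as a direct summand. -/
noncomputable def mult (a : V) (M : FGModuleCat.{u} R) : ℤ :=
  (Module.length R (p.arrowSocle M)).toNat - (Module.length R (p.arrowSocleRad M a)).toNat

theorem mult_congr (a : V) {M N : FGModuleCat.{u} R} (e : M ≃ₗ[R] N) :
    p.mult a M = p.mult a N := by
  rw [mult, mult, ((e.submoduleMap _).trans (.ofEq _ _ (p.map_arrowSocle e))).length_eq,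
    ((e.submoduleMap _).trans (.ofEq _ _ (p.map_arrowSocleRad e a))).length_eq]

theorem mult_eq_zero {a : V} {M : FGModuleCat.{u} R}
    (h : ∀ y : M, (∀ i, p.x i • y = 0) → ∀ f : M →ₗ[R] p.simple a, f y = 0) :
    p.mult a M = 0 := by
  have : p.arrowSocleRad M a = p.arrowSocle M := by
    ext y
    rw [mem_arrowSocleRad, mem_arrowSocle]
    exact ⟨fun hy => hy.1, fun hy => ⟨hy, h y hy⟩⟩
  rw [mult, this, sub_self]

theorem mult_prod [IsArtinianRing R] (a : V) (M N : FGModuleCat.{u} R) :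
    p.mult a (FGModuleCat.of R (M × N)) = p.mult a M + p.mult a N := by
  have h1 : Module.length R (p.arrowSocle (M × N))
      = Module.length R (p.arrowSocle M) + Module.length R (p.arrowSocle N) := by
    rw [arrowSocle_prod, (Submodule.prodLinearEquiv _ _).length_eq, Module.length_prod]
  have h2 : Module.length R (p.arrowSocleRad (M × N) a)
      = Module.length R (p.arrowSocleRad M a) + Module.length R (p.arrowSocleRad N a) := by
    rw [arrowSocleRad_prod, (Submodule.prodLinearEquiv _ _).length_eq, Module.length_prod]
  change ((Module.length R (p.arrowSocle (M × N))).toNat : ℤ)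
    - (Module.length R (p.arrowSocleRad (M × N) a)).toNat = _
  rw [h1, h2, ENat.toNat_add Module.length_ne_top Module.length_ne_top,
    ENat.toNat_add Module.length_ne_top Module.length_ne_top, mult, mult]
  push_cast
  ring

theorem mult_pos [IsArtinianRing R] {a : V} {M : FGModuleCat.{u} R} {y : M} (hy : ∀ i, p.x i • y = 0)
    (f : M →ₗ[R] p.simple a) (hf : f y ≠ 0) : 0 < p.mult a M := by
  have hlt : p.arrowSocleRad M a < p.arrowSocle M := by
    refine lt_of_le_of_ne inf_le_left fun h => hf ?_
    have h1 : y ∈ p.arrowSocle M := hy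
    rw [← h, mem_arrowSocleRad] at h1
    exact h1.2 f
  have h2 : Module.length R (p.arrowSocleRad M a) < Module.length R (p.arrowSocle M) := by
    rw [Module.length_submodule, Module.length_submodule]
    exact Submodule.height_strictMono hlt
  rw [mult, sub_pos, Nat.cast_lt]
  rwa [← ENat.natCast_lt_natCast, ENat.natCast_toNat Module.length_ne_top, ENat.natCast_toNat Module.length_ne_top]

/-- If `x i` kills the class of `r`, then `x i * r`, a multiple of `x i`, lies in `L`. So the
coefficient of `r` at the source is zero, and every map to the simple module there kills the class.
-/
theorem mult_quotient_eq_zero {L : Submodule R R} {i : E} (hi : p.x i ∉ L) :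
    p.mult (p.source i) (FGModuleCat.of R (R ⧸ L)) = 0 := by
  refine p.mult_eq_zero fun y hy f => ?_
  obtain ⟨r, rfl⟩ := L.mkQ_surjective y
  have h1 : p.x i * r ∈ L := (Submodule.Quotient.mk_eq_zero L).1 (hy i)
  have h2 : p.c (p.source i) r = 0 := by
    by_contra h
    refine hi ?_
    have := L.smul_mem (algebraMap k R (p.c (p.source i) r)⁻¹) h1
    rwa [p.x_mul, smul_eq_mul, ← Algebra.smul_def, smul_smul, inv_mul_cancel₀ h, one_smul] at this
  have h3 : L.mkQ r = r • L.mkQ 1 := by rw [← map_smul, smul_eq_mul, mul_one]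
  rw [h3]
  exact (map_smul f r _).trans (p.smul_simple_eq_zero h2 _)

/-- A map to the simple module lifts to `g : P → R`, and `x i * g y = 0` forces the coefficient of
`g y` at the source to vanish. This is what lets the multiplicity descend to `K₀`. -/
theorem mult_projective (i : E) (P : FGModuleCat.{u} R) (hP : Module.Projective R P) :
    p.mult (p.source i) P = 0 := by
  refine p.mult_eq_zero fun y hy f => ?_
  obtain ⟨g, hg⟩ := Module.projective_lifting_property (p.vertexIdeal (p.source i)).mkQ f
    (Submodule.mkQ_surjective _)
  rw [← hg]
  refine (Submodule.Quotient.mk_eq_zero _).2 ?_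
  have h1 : p.x i * g y = 0 := by
    rw [← smul_eq_mul, ← map_smul, hy, map_zero]
  rw [p.x_mul] at h1
  exact (smul_eq_zero.1 h1).resolve_right (p.x_ne_zero i)

/-- The class of `e a` is killed by all arrows and survives in the simple module at `a`. -/
theorem mult_quotient_pos [IsArtinianRing R] {L : Submodule R R} {a : V} (hL : ∀ r ∈ L, p.c a r = 0)
    (hx : ∀ i, p.source i = a → p.x i ∈ L) : 0 < p.mult a (FGModuleCat.of R (R ⧸ L)) := by
  refine p.mult_pos (y := L.mkQ (p.e a)) (fun i => ?_)
    (L.liftQ (p.vertexIdeal a).mkQ fun r hr => ?_) ?_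
  · refine (Submodule.Quotient.mk_eq_zero L).2 ?_
    change p.x i * p.e a ∈ L
    rw [p.x_mul, p.c_e]
    split_ifs with h
    · rw [one_smul]; exact hx i h
    · rw [zero_smul]; exact zero_mem _
  · exact (Submodule.Quotient.mk_eq_zero _).2 (hL r hr)
  · intro h
    have h1 : p.c a (p.e a) = 0 := (Submodule.Quotient.mk_eq_zero _).1 h
    rw [p.c_e_self] at h1
    exact one_ne_zero h1

/-- The multiplicity of the simple module at the source of `i` as an invariant on `K₀`. -/
noncomputable def multHom [IsArtinianRing R] (i : E) : K0 R →+ ℤ :=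
  K0.lift (p.mult (p.source i)) (fun _ _ ⟨e⟩ => p.mult_congr _ e) (p.mult_prod _)
    (p.mult_projective i)

theorem multHom_mk [IsArtinianRing R] (i : E) (M : FGModuleCat.{u} R) :
    p.multHom i (K0.mk M) = p.mult (p.source i) M :=
  K0.lift_mk _ _ _ _ M

theorem not_projective_simple [IsArtinianRing R] (i : E) :
    ¬ Module.Projective R (p.simple (p.source i)) := fun h =>
  (p.mult_quotient_pos (L := p.vertexIdeal (p.source i)) (fun _ hr => hr)
    fun _ _ => p.c_x _ _).ne' (p.mult_projective i _ h)

end Multiplicity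

variable [IsArtinianRing R]

theorem omegaBar_mk_quotient_arrow (i : E) :
    omegaBar R (K0.mk (FGModuleCat.of R (R ⧸ p.arrowSpan {i})))
      = K0.mk (p.simple (p.target i)) := by
  rw [omegaBar_mk_quotient]
  exact (K0.mk_congr (N := FGModuleCat.of R (p.arrowSpan {i})) (p.simpleEquivArrowSpan i)).symm

/-! ### Injectivity of `Ω̄` forces self-injectivity -/

section Injective

/-- Split the arrows leaving a vertex into `{i}` and the rest `T`, which contains `j`. The ideal of
their union is the direct sum of the two ideals, so the class of the quotient by it would be the sum
of the classes of the two quotients. The simple module at the vertex has positive multiplicity in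
the former and zero in both of the latter. -/
theorem source_injective_of_omegaBar_injective (hinj : Function.Injective (omegaBar R)) :
    Function.Injective p.source := by
  intro i j hij
  by_contra hne
  let T : Set E := {l | p.source l = p.source i ∧ l ≠ i}
  have hiT : i ∉ T := fun h => h.2 rfl
  have hd : Disjoint {i} T := Set.disjoint_singleton_left.2 hiT
  have h1 : K0.mk (FGModuleCat.of R (R ⧸ p.arrowSpan ({i} ∪ T)))
      = K0.mk (FGModuleCat.of R (R ⧸ p.arrowSpan {i}))
        + K0.mk (FGModuleCat.of R (R ⧸ p.arrowSpan T)) := by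
    refine hinj ?_
    rw [map_add, omegaBar_mk_quotient, omegaBar_mk_quotient, omegaBar_mk_quotient]
    exact K0.mk_eq_add (M := FGModuleCat.of R (p.arrowSpan ({i} ∪ T)))
      (M' := FGModuleCat.of R (p.arrowSpan {i})) (M'' := FGModuleCat.of R (p.arrowSpan T))
      (p.arrowSpanUnionEquiv hd)
  have h2 := congrArg (p.multHom i) h1
  rw [map_add, multHom_mk, multHom_mk, multHom_mk,
    p.mult_quotient_eq_zero (p.x_notMem_arrowSpan hiT), add_zero, hij,
    p.mult_quotient_eq_zero (p.x_notMem_arrowSpan (Set.notMem_singleton_iff.2 (Ne.symm hne))),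
    ← hij] at h2
  refine (p.mult_quotient_pos (fun _ hr => p.c_eq_zero_of_mem_arrowSpan hr _) fun l hl => ?_).ne' h2
  by_cases hli : l = i
  · exact p.x_mem_arrowSpan (.inl hli)
  · exact p.x_mem_arrowSpan (.inr ⟨hl, hli⟩)

theorem mult_quotient_arrow_pos (hinj : Function.Injective (omegaBar R)) (i : E) :
    0 < p.mult (p.source i) (FGModuleCat.of R (R ⧸ p.arrowSpan {i})) :=
  p.mult_quotient_pos (fun _ hr => p.c_eq_zero_of_mem_arrowSpan hr _) fun _ hl =>
    p.x_mem_arrowSpan (p.source_injective_of_omegaBar_injective hinj hl)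

/-- Arrows with a common target span isomorphic ideals, yet the multiplicity at the source of `i`
separates the two quotients. -/
theorem target_injective_of_omegaBar_injective (hinj : Function.Injective (omegaBar R)) :
    Function.Injective p.target := by
  intro i j hij
  by_contra hne
  have h1 : K0.mk (FGModuleCat.of R (R ⧸ p.arrowSpan {i}))
      = K0.mk (FGModuleCat.of R (R ⧸ p.arrowSpan {j})) := by
    refine hinj ?_
    rw [omegaBar_mk_quotient_arrow, omegaBar_mk_quotient_arrow, hij]
  have h2 := congrArg (p.multHom i) h1
  rw [multHom_mk, multHom_mk, p.mult_quotient_eq_zero (p.x_notMem_arrowSpan (Set.notMem_singleton_iff.2 hne))] at h2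
  exact (p.mult_quotient_arrow_pos hinj i).ne' h2

/-- Were the target a sink, the ideal of `x i` would be projective and the quotient would have class
zero, against its positive multiplicity. -/
theorem exists_source_eq_target_of_omegaBar_injective
    (hinj : Function.Injective (omegaBar R)) (i : E) :
    ∃ j, p.source j = p.target i := by
  by_contra! h
  have h1 : K0.mk (FGModuleCat.of R (R ⧸ p.arrowSpan {i})) = 0 := by
    refine hinj ?_
    rw [omegaBar_mk_quotient_arrow, map_zero]
    exact K0.mk_eq_zero _ (p.projective_simple h)
  have h2 := congrArg (p.multHom i) h1
  rw [multHom_mk, map_zero] at h2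
  exact (p.mult_quotient_arrow_pos hinj i).ne' h2

/-- If `Ω̄` is injective on `K₀`, then the ring is self-injective. -/
theorem injective_self_of_omegaBar_injective (p : ArrowPresentation k R V E)
    [Module.Finite k R]
    (hinj : Function.Injective (omegaBar R)) : Module.Injective R R :=
  p.injective_self (p.exists_source_eq_target_of_omegaBar_injective hinj)
    (p.target_injective_of_omegaBar_injective hinj)

end Injective

/-! ### The image of `Ω̄` -/

section Syzygy

/-- The syzygies are annihilated by the arrows and have no component at the sources. -/
theorem smul_syzygy (M : FGModuleCat.{u} R) (z : syzygy M) :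
    (∀ i, p.x i • z = 0) ∧ ∀ b, (∀ i, p.target i ≠ b) → p.e b • z = 0 := by
  have hc := isProjectiveCover_coverMap M
  -- The section `s` embeds the cover in a free module, where the action can be computed
  -- coordinatewise.
  obtain ⟨s, hs⟩ := Module.projective_def'.1 hc.projective
  have hs' : ∀ y : coverModule M, s y = 0 → y = 0 := fun y hy => by
    have := LinearMap.congr_fun hs y
    rw [LinearMap.comp_apply, hy, map_zero] at this
    exact this.symm
  -- A coordinate of `s` followed by `R → simple a` is a map from the cover to a simple module, so
  -- it kills the syzygy.
  have h0 : ∀ (a : V) (y : coverModule M), p.c a (s z.1 y) = 0 := fun a y => by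
    have hs : IsSimpleModule R (R ⧸ p.vertexIdeal a) := p.isSimpleModule_simple a
    have := hc.apply_eq_zero ((p.vertexIdeal a).mkQ ∘ₗ Finsupp.lapply y ∘ₗ s) (z := z.1) z.2
    exact (Submodule.Quotient.mk_eq_zero _).1 this
  refine ⟨fun i => Subtype.ext (hs' _ ?_), fun b hb => Subtype.ext (hs' _ ?_)⟩
  · refine Finsupp.ext fun y => ?_
    change s (p.x i • z.1) y = 0
    rw [map_smul, Finsupp.smul_apply, smul_eq_mul, p.x_mul, h0, zero_smul]
  · refine Finsupp.ext fun y => ?_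
    change s (p.e b • z.1) y = 0
    rw [map_smul, Finsupp.smul_apply, smul_eq_mul, p.e_mul_of_not_target hb, h0, zero_smul]

/-- An indecomposable summand of a syzygy is simple at some vertex `b`, which must be a target. If
`b` is a source the summand is in the list up to isomorphism; if `b` is a sink it is projective,
with class zero. -/
theorem addSpan_syzygy_le (p : ArrowPresentation k R V E)
    {m : ℕ} {S : Fin m → FGModuleCat.{u} R} (hS : IsRepresentativeList S)
    (M : FGModuleCat.{u} R) : addSpan (syzygy M) ≤ addSpan (directSum S) := by
  unfold addSpan
  rw [AddSubgroup.closure_le]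
  rintro _ ⟨T, hT, hTM, rfl⟩
  obtain ⟨f, hf⟩ := hTM.exists_injective
  have hx : ∀ i (y : T), p.x i • y = 0 := fun i y => hf (by
    rw [map_smul, (p.smul_syzygy M _).1, map_zero])
  have hss := p.isSemisimpleModule_of_x_smul hx
  have hsimple := hT.isSimpleModule
  have := hT.1
  obtain ⟨b, y, hy⟩ := p.exists_e_smul_ne_zero (M := T)
  obtain ⟨e⟩ := p.nonempty_equiv_simple hy
  by_cases hb : ∃ i, p.source i = b
  · obtain ⟨i, rfl⟩ := hb
    have hb' : ∃ j, p.target j = p.source i := by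
      by_contra! h
      refine hy (hf ?_)
      rw [map_smul, (p.smul_syzygy M _).2 _ h, map_zero]
    obtain ⟨j, hj⟩ := hb'
    have hD : IsSimpleNotProjNotInj (p.simple (p.source i)) := by
      refine ⟨inferInstance, p.not_projective_simple i, ?_⟩
      rw [← hj]
      exact p.not_injective_simple j
    obtain ⟨l, ⟨e'⟩⟩ := hS.exists_iso _ hD
    rw [SetLike.mem_coe, K0.mk_congr (e.trans e')]
    have : IsSimpleModule R (S l) := (hS.mem l).1
    exact AddSubgroup.subset_closure
      ⟨S l, indecomposable_of_isSimpleModule _, isSummand_directSum S l, rfl⟩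
  · push Not at hb
    rw [SetLike.mem_coe, K0.mk_congr e, K0.mk_eq_zero _ (p.projective_simple hb)]
    exact zero_mem _

/-- The image of `Ω̄` is generated by the simple modules that are neither projective nor
injective. -/
theorem addSpan_directSum_eq_range (p : ArrowPresentation k R V E)
    {m : ℕ} {S : Fin m → FGModuleCat.{u} R}
    (hS : IsRepresentativeList S) :
    (addSpan (directSum S) : Set (K0 R)) = Set.range (omegaBar R) := by
  rw [← AddMonoidHom.coe_range, SetLike.coe_set_eq]
  refine le_antisymm ?_ ?_
  · rw [addSpan_directSum_eq S fun l => (hS.mem l).1, AddSubgroup.closure_le]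
    rintro _ ⟨l, rfl⟩
    obtain ⟨hsimple, -, hni⟩ := hS.mem l
    have := IsSimpleModule.nontrivial R (S l)
    obtain ⟨b, y, hy⟩ := p.exists_e_smul_ne_zero (M := S l)
    obtain ⟨e⟩ := p.nonempty_equiv_simple hy
    -- A simple module at a vertex that is no target would be injective.
    have hb : ∃ i, p.target i = b := by
      by_contra! h
      exact hni (Module.Baer.injective
        (Module.Baer.of_equiv e.symm (Module.Baer.of_injective (p.injective_simple h))))
    obtain ⟨i, rfl⟩ := hb
    exact ⟨_, (p.omegaBar_mk_quotient_arrow i).trans (K0.mk_congr e).symm⟩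
  · rintro _ ⟨x, rfl⟩
    induction x using K0.induction with
    | h0 => rw [map_zero]; exact zero_mem _
    | hmk M => rw [omegaBar_mk]; exact p.addSpan_syzygy_le hS M (mk_mem_addSpan _)
    | hneg x h => rw [map_neg]; exact neg_mem h
    | hadd x y hx hy => rw [map_add]; exact add_mem hx hy

/-- The `φ`-dimension of a radical square zero ring that is not self-injective. -/
theorem phiDim_eq_phi_directSum_add_one (p : ArrowPresentation k R V E)
    [Module.Finite k R] (hR : ¬ Module.Injective R R) {m : ℕ}
    {S : Fin m → FGModuleCat.{u} R} (hS : IsRepresentativeList S) :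
    phiDim R = phi (directSum S) + 1 ∧ phiDim R ≠ ⊤ ∧
      ∃ N : FGModuleCat.{u} R, phi N = phiDim R :=
  phiDim_eq_phi_add_one _ (p.addSpan_directSum_eq_range hS)
    (by
      rw [addSpan_directSum_eq S fun l => (hS.mem l).1]
      exact ⟨(Set.finite_range _).toFinset, by rw [Set.Finite.coe_toFinset]⟩)
    fun h => hR (p.injective_self_of_omegaBar_injective h)

end Syzygy

end ArrowPresentation

theorem proposition4p9 (k : Type u) [Field k] (V : Type v) [Quiver.{w} V] [Fintype V]
    [∀ a b : V, Finite (a ⟶ b)] [Nonempty V]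
    (hconn : Subsingleton (Quiver.WeaklyConnectedComponent V))
    (hA : ¬ Module.Injective (RadSqZeroAlgebra k V)ᵐᵒᵖ (RadSqZeroAlgebra k V))
    {m : ℕ} (S : Fin m → FGModuleCat.{max u v w} (RadSqZeroAlgebra k V)ᵐᵒᵖ)
    (hS : IgusaTodorov.IsRepresentativeList S) :
    IgusaTodorov.phiDim (RadSqZeroAlgebra k V)ᵐᵒᵖ
        = IgusaTodorov.phi (IgusaTodorov.directSum S) + 1 ∧
      IgusaTodorov.phiDim (RadSqZeroAlgebra k V)ᵐᵒᵖ ≠ ⊤ ∧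
      ∃ M : FGModuleCat.{max u v w} (RadSqZeroAlgebra k V)ᵐᵒᵖ,
        IgusaTodorov.phi M = IgusaTodorov.phiDim (RadSqZeroAlgebra k V)ᵐᵒᵖ := by
  have := Fintype.ofFinite (Σ a b : V, (a ⟶ b))
  refine (RadSqZeroAlgebra.arrowPresentation k V).phiDim_eq_phi_directSum_add_one (fun h => hA ?_)
    hS
  -- The opposite ring as a left module over itself is `A` as a right module, so self-injectivity
  -- transfers.
  let e : (RadSqZeroAlgebra k V)ᵐᵒᵖ ≃ₗ[(RadSqZeroAlgebra k V)ᵐᵒᵖ] RadSqZeroAlgebra k V :=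
    { MulOpposite.opAddEquiv.symm with
      map_smul' := fun _ _ => rfl }
  exact Module.Baer.injective (Module.Baer.of_equiv e (Module.Baer.of_injective h))
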